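/- Let $d\ge 2$ be an integer, let $\mathbb{Q}$ be a probability measure on $\mathbb{R}_+=[0,\infty)$, and let $Y$ be a random variable with distribution $\mathbb{Q}$. Write $e_d=(0,\dots,0,1)$ and $B(x,a)$ for the closed Euclidean ball in $\mathbb{R}^d$ with centre $x$ and radius $a\ge 0$ (so $B(x,0)=\{x\}$), and let $D^o$ and $\partial D$ denote the interior and the boundary of a set $D$. Say that $x$ is lower than $y$ if $\langle x,e_d\rangle<\langle y,e_d\rangle$, and that $x$ is a local minimum of $D\subset\mathbb{R}^d$ if $x\in D$ and $x$ is lower than every other point of $D\cap U$ for some neighbourhood $U$ of $x$. For a set $\psi=\{(x_1,a_1),\dots,(x_d,a_d)\}$ of $d$ distinct elements of $\mathbb{R}^d\times\mathbb{R}_+$, let $h^{(1)}(\psi)=1$ if $\bigcap_{i=1}^d\partial B(x_i,a_i)$ consists of exactly two points $p,q$, named so that $p$ is lower than $q$ (or, if they have the same height, so that $p$ precedes $q$ lexicographically), and $q$ is a local minimum of $\mathbb{R}^d\setminus\bigcup_{i=1}^d B(x_i,a_i)^o$. In all other cases let $h^{(1)}(\psi)=0$. With $o$ the origin and $\lambda_d$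 Lebesgue measure on $\mathbb{R}^d$, define for $a_1,\dots,a_d\in\mathbb{R}_+$ $$G(a_1,\dots,a_d)=\frac1{d!}\int_{(\mathbb{R}^d)^{d-1}}h^{(1)}(\{(o,a_1),(x_2,a_2),\dots,(x_d,a_d)\})\,\lambda_d^{d-1}(d(x_2,\dots,x_d)),$$ $$c_0=\int_{\mathbb{R}_+^d}G(a_1,\dots,a_d)\prod_{i=1}^d\mathbb{Q}(da_i).$$ Let $\theta_d=\lambda_d(B(o,1))$. Then the following hold. 1. For all $s_1,\dots,s_d\in\mathbb{R}_+$ the integrand defining $G(s_1,\dots,s_d)$ is integrable, and $$G(s_1,\dots,s_d)=\frac{\pi^{(d^2-1)/2}}{d!\,\Gamma((1+d)/2)^{d-1}}\prod_{i=1}^d s_i^{d-1}.$$ 2. If $\mathbb{E}[Y^{d-1}]<\infty$, then $G$ is integrable with respect to $\mathbb{Q}^{\otimes d}$, and $$c_0=\frac{(\mathbb{E}[Y^{d-1}])^d\,\theta_d^{d-1}}{d!}\Big(\frac{\sqrt\pi\,\Gamma(1+d/2)}{\Gamma((1+d)/2)}\Big)^{d-1}=\frac{(\mathbb{E}[Y^{d-1}])^d\,\pi^{(d^2-1)/2}}{d!\,\Gamma((1+d)/2)^{d-1}}.$$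 3. If $0<\mathbb{E}[Y^d]<\infty$ and $\alpha=\theta_d\,\mathbb{E}[Y^d]$, then $c_0$ agrees with the Hall–Janson constant: for every integer $k\ge1$, $$\frac{c_0\,\alpha^{1-d}}{(k-1)!}=c_{d,k,Y}:=\frac1{d!\,(k-1)!}\Big(\frac{\sqrt\pi\,\Gamma(1+d/2)}{\Gamma((d+1)/2)}\Big)^{d-1}\frac{(\mathbb{E}[Y^{d-1}])^d}{(\mathbb{E}[Y^d])^{d-1}}.$$ -/

import Mathlib

open MeasureTheory ProbabilityTheory
open scoped NNReal Nat

noncomputable section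

namespace BooleanCoverage

/-- Euclidean `d`-space `ℝ^d`. -/
abbrev E (d : ℕ) : Type := EuclideanSpace ℝ (Fin d)

/-- The height `⟨x, e_d⟩` of a point, i.e. its last coordinate. -/
def height {d : ℕ} [NeZero d] (x : E d) : ℝ :=
  x ⟨d - 1, Nat.sub_one_lt (NeZero.ne d)⟩

/-- `x` is lower than `y`. -/
def Lower {d : ℕ} [NeZero d] (x y : E d) : Prop := height x < height y

/-- `p` is lower than `q`, or they have equal height and `p` precedes `q` lexicographically. -/
def Before {d : ℕ} [NeZero d] (p q : E d) : Prop :=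
  Lower p q ∨ (height p = height q ∧ toLex (WithLp.ofLp p) < toLex (WithLp.ofLp q))

/-- `x` is a local minimum of the set `D`: it lies in `D` and is (strictly) lower than every other
point of `D` in some neighbourhood of `x`. -/
def IsLocalMinimum {d : ℕ} [NeZero d] (D : Set (E d)) (x : E d) : Prop :=
  x ∈ D ∧ ∃ U ∈ nhds x, ∀ y ∈ D ∩ U, y ≠ x → Lower x y

/-- The intersection of the boundaries of the balls `B(x, r a)`, `(x, a) ∈ ψ`. -/
def spheresInter {d : ℕ} (r : ℝ) (ψ : Set (E d × ℝ≥0)) : Set (E d) :=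
  ⋂ z ∈ ψ, frontier (Metric.closedBall z.1 (r * z.2))

/-- The complement of the union of the interiors of the balls `B(x, r a)`, `(x, a) ∈ ψ`. -/
def openBallsCompl {d : ℕ} (r : ℝ) (ψ : Set (E d × ℝ≥0)) : Set (E d) :=
  (⋃ z ∈ ψ, interior (Metric.closedBall z.1 (r * z.2)))ᶜ

open Classical in
/-- The indicator `h^{(r)}(ψ)` that `ψ` consists of `d` marked points, that the intersection of the
`d` spheres consists of exactly two points `p`, `q` (named so that `p` comes before `q`), and that
`q` is a local minimum of the complement of the open balls. -/
def h {d : ℕ} [NeZero d] (r : ℝ) (ψ : Set (E d × ℝ≥0)) : ℝ :=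
  if ψ.encard = d ∧ (spheresInter r ψ).encard = 2 ∧
      ∃ p ∈ spheresInter r ψ, ∃ q ∈ spheresInter r ψ,
        Before p q ∧ IsLocalMinimum (openBallsCompl r ψ) q
  then 1 else 0

/-- The marked point set `{(o, a₁), (x₂, a₂), …, (x_d, a_d)}`. The indices `1, …, d` are the
elements of `Fin d`, and `0 : Fin d` is the first of them. -/
def config {d : ℕ} [NeZero d] (a : Fin d → ℝ≥0) (x : {i : Fin d // i ≠ 0} → E d) :
    Set (E d × ℝ≥0) :=
  insert (0, a 0) (Set.range fun i : {i : Fin d // i ≠ 0} => (x i, a i))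

/-- `G(a₁, …, a_d)`: `1 / d!` times the integral of `h^{(1)}` over `(x₂, …, x_d)`, with respect to
Lebesgue measure on `(ℝ^d)^{d-1}`. -/
def G {d : ℕ} [NeZero d] (a : Fin d → ℝ≥0) : ℝ :=
  1 / (d ! : ℝ) * ∫ x : {i : Fin d // i ≠ 0} → E d, h 1 (config a x)

/-- The constant `c₀`, the integral of `G` with respect to the `d`-fold product of `Q`. -/
def c₀ (d : ℕ) [NeZero d] (Q : Measure ℝ≥0) : ℝ :=
  ∫ a : Fin d → ℝ≥0, G a ∂(Measure.pi fun _ => Q)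

/-- The moment `𝔼[Y ^ m]`. -/
def moment {Ω : Type*} [MeasurableSpace Ω] (P : Measure Ω) (Y : Ω → ℝ≥0) (m : ℕ) : ℝ :=
  ∫ ω, (Y ω : ℝ) ^ m ∂P

/-- `θ_d`, the volume of the unit ball of `ℝ^d`. -/
def θ (d : ℕ) : ℝ := (volume (Metric.closedBall (0 : E d) 1)).toReal

/-- `α = θ_d 𝔼[Y ^ d]`, the expected volume of a ball of radius `Y`. -/
def α {Ω : Type*} [MeasurableSpace Ω] (d : ℕ) (P : Measure Ω) (Y : Ω → ℝ≥0) : ℝ :=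
  θ d * moment P Y d

/-- The Hall–Janson constant `c_{d,k,Y}`. -/
def hallJanson {Ω : Type*} [MeasurableSpace Ω] (d k : ℕ) (P : Measure Ω) (Y : Ω → ℝ≥0) : ℝ :=
  1 / ((d ! : ℝ) * ((k - 1)! : ℝ)) *
    (√Real.pi * Real.Gamma (1 + d / 2) / Real.Gamma ((d + 1) / 2)) ^ (d - 1) *
    (moment P Y (d - 1) ^ d / moment P Y d ^ (d - 1))

end BooleanCoverage

end

/-! Seen from the second point `q` of the intersection, the centres are `q + y i` with
`‖y i‖ = a i`, and `q` is a local minimum exactly when the `y i` are linearly independent and their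
open simplicial cone contains `-e_d`. Choosing the signs of the `y i` turns exactly one of `2 ^ d`
families into such a family, so that the integral of `|det y|` over these families against a
rotation invariant weight is `2⁻ᵈ` times its integral over all families, which for the Gaussian
weight is a product of radial moments by a recursion over the columns. Finally, the change of
variables from `y` to the norms `‖y i‖` together with the differences
`a i • y i / ‖y i‖ - a 0 • y 0 / ‖y 0‖` has the Jacobian `|det y| * ∏ a i ^ (d - 1) / ‖y i‖ ^ d`,
which separates the volume of the admissible centres from the radial integrals. -/

namespace BooleanCoverage

open Module Set Metric
open scoped ENNReal RealInnerProductSpace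

section GaussianDeterminant

theorem lintegral_fun_norm_addHaar {V : Type*} [NormedAddCommGroup V] [NormedSpace ℝ V]
    [Nontrivial V] [FiniteDimensional ℝ V] [MeasurableSpace V] [BorelSpace V] (μ : Measure V)
    [μ.IsAddHaarMeasure] {f : ℝ → ℝ≥0∞} (hf : Measurable f) :
    ∫⁻ x, f ‖x‖ ∂μ =
      finrank ℝ V * μ (ball 0 1) * ∫⁻ r in Ioi 0, ENNReal.ofReal (r ^ (finrank ℝ V - 1)) * f r := by
  have hf' : Measurable fun r : Ioi (0 : ℝ) => f r := hf.comp measurable_subtype_coe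
  calc ∫⁻ x, f ‖x‖ ∂μ
      = ∫⁻ x : ({0}ᶜ : Set V), f ‖x.1‖ ∂(μ.comap (↑)) := by
        rw [lintegral_subtype_comap (measurableSet_singleton _).compl fun x => f ‖x‖,
          restrict_compl_singleton]
    _ = ∫⁻ z, f z.2 ∂μ.toSphere.prod (.volumeIoiPow (finrank ℝ V - 1)) := by
        simpa using μ.measurePreserving_homeomorphUnitSphereProd.lintegral_comp
          (hf'.comp measurable_snd)
    _ = μ.toSphere univ * ∫⁻ r : Ioi (0 : ℝ), f r ∂.volumeIoiPow (finrank ℝ V - 1) := by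
        simpa using lintegral_prod_mul (μ := μ.toSphere)
          (ν := .volumeIoiPow (finrank ℝ V - 1)) aemeasurable_one hf'.aemeasurable
    _ = _ := by
        rw [μ.toSphere_apply_univ, Measure.volumeIoiPow,
          lintegral_withDensity_eq_lintegral_mul _ (by fun_prop) hf',
          ← lintegral_subtype_comap measurableSet_Ioi]
        rfl

theorem measurePreserving_cons (n : ℕ) (X : Type*) [MeasureSpace X]
    [SigmaFinite (volume : Measure X)] :
    MeasurePreserving fun p : X × (Fin n → X) => (Fin.cons p.1 p.2 : Fin (n + 1) → X) := by
  convert (volume_preserving_piFinSuccAbove (fun _ : Fin (n + 1) => X) 0).symm using 1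
  exact funext fun p => (Fin.insertNth_zero' _ _).symm

theorem lintegral_pi_prod_eq_pow {X : Type*} [MeasureSpace X] [SigmaFinite (volume : Measure X)]
    {f : X → ℝ≥0∞} (hf : Measurable f) (n : ℕ) :
    ∫⁻ x : Fin n → X, ∏ i, f (x i) = (∫⁻ x, f x) ^ n := by
  induction n with
  | zero => simp [volume_pi]
  | succ n ih =>
    rw [← (measurePreserving_cons n X).lintegral_comp (by fun_prop), Measure.volume_eq_prod]
    simp only [Fin.prod_univ_succ, Fin.cons_zero, Fin.cons_succ]
    rw [lintegral_prod_mul hf.aemeasurable (g := fun x : Fin n → X => ∏ i, f (x i))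
      (Measurable.aemeasurable (by fun_prop)), ih, pow_succ']

/-- The Gaussian density `exp (-π ‖v‖²)`, normalised to have integral `1` in every dimension. -/
noncomputable def gauss {V : Type*} [Norm V] (v : V) : ℝ≥0∞ :=
  ENNReal.ofReal (Real.exp (-(Real.pi * ‖v‖ ^ 2)))

theorem gauss_congr_norm {V W : Type*} [Norm V] [Norm W] {v : V} {w : W} (h : ‖v‖ = ‖w‖) :
    gauss v = gauss w := by
  rw [gauss, gauss, h]

@[fun_prop]
theorem measurable_gauss {V : Type*} [SeminormedAddCommGroup V] [MeasurableSpace V]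
    [OpensMeasurableSpace V] : Measurable (gauss : V → ℝ≥0∞) := by
  unfold gauss
  fun_prop

theorem lintegral_gauss (V : Type*) [NormedAddCommGroup V] [InnerProductSpace ℝ V]
    [FiniteDimensional ℝ V] [MeasurableSpace V] [BorelSpace V] : ∫⁻ v : V, gauss v = 1 := by
  have h : ∫ v : V, Real.exp (-(Real.pi * ‖v‖ ^ 2)) = 1 := by
    simpa [Real.pi_ne_zero] using GaussianFourier.integral_rexp_neg_mul_sq_norm (V := V)
      Real.pi_pos
  unfold gauss
  rw [← ofReal_integral_eq_lintegral_ofReal, h, ENNReal.ofReal_one]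
  · exact not_imp_comm.1 integral_undef (h ▸ one_ne_zero)
  · exact .of_forall fun v => (Real.exp_pos _).le

/-- The `n`-th moment `∫₀^∞ rⁿ exp (-π r²) dr` of the Gaussian density on the positive half-line. -/
noncomputable def radialMoment (n : ℕ) : ℝ≥0∞ :=
  ∫⁻ r in Ioi (0 : ℝ), ENNReal.ofReal r ^ n * gauss r

theorem two_mul_radialMoment (n : ℕ) :
    2 * radialMoment n =
      ENNReal.ofReal (Real.pi ^ (-((n + 1) / 2 : ℝ)) * Real.Gamma ((n + 1) / 2)) := by
  have hn : (-1 : ℝ) < n := by linarith [(Nat.cast_nonneg n : (0 : ℝ) ≤ n)]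
  have hr : radialMoment n =
      ∫⁻ r in Ioi (0 : ℝ), ENNReal.ofReal (r ^ (n : ℝ) * Real.exp (-Real.pi * r ^ (2 : ℝ))) := by
    refine setLIntegral_congr_fun measurableSet_Ioi fun r (hr : 0 < r) => ?_
    rw [gauss, ← ENNReal.ofReal_pow hr.le, ← ENNReal.ofReal_mul (by positivity),
      Real.rpow_natCast, Real.rpow_two, Real.norm_eq_abs, sq_abs, neg_mul]
  rw [hr, ← ofReal_integral_eq_lintegral_ofReal,
    integral_rpow_mul_exp_neg_mul_rpow two_pos hn Real.pi_pos,
    ← ENNReal.ofReal_ofNat 2, ← ENNReal.ofReal_mul two_pos.le]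
  · congr 1
    ring_nf
  · simpa only [Real.rpow_two] using! integrableOn_rpow_mul_exp_neg_mul_sq Real.pi_pos hn
  · filter_upwards [ae_restrict_mem measurableSet_Ioi] with r (hr : 0 < r)
    positivity

theorem two_mul_radialMoment_zero : 2 * radialMoment 0 = 1 := by
  have h := lintegral_fun_norm_addHaar (V := ℝ) volume measurable_gauss
  simp only [gauss_congr_norm (norm_norm _), lintegral_gauss] at h
  simpa [radialMoment] using h.symm

theorem radialMoment_ne_zero (n : ℕ) : radialMoment n ≠ 0 := by
  refine right_ne_zero_of_mul (a := 2) ?_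
  rw [two_mul_radialMoment, ENNReal.ofReal_ne_zero_iff]
  positivity

theorem radialMoment_ne_top (n : ℕ) : radialMoment n ≠ ∞ := fun h =>
  ENNReal.ofReal_ne_top ((two_mul_radialMoment n).symm.trans (by rw [h]; simp))

theorem radialMoment_mul_lintegral_enorm_mul_gauss (V : Type*) [NormedAddCommGroup V]
    [InnerProductSpace ℝ V] [FiniteDimensional ℝ V] [Nontrivial V] [MeasurableSpace V]
    [BorelSpace V] :
    radialMoment (finrank ℝ V - 1) * ∫⁻ v : V, ‖v‖ₑ * gauss v = radialMoment (finrank ℝ V) := by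
  obtain ⟨n, hn⟩ := Nat.exists_eq_add_one.2 (finrank_pos (R := ℝ) (M := V))
  have hmass := lintegral_fun_norm_addHaar (volume : Measure V) measurable_gauss
  have hnorm := lintegral_fun_norm_addHaar (volume : Measure V) (f := fun r => ‖r‖ₑ * gauss r)
    (by fun_prop)
  have hmoment : ∀ k, ∫⁻ r in Ioi (0 : ℝ), ENNReal.ofReal (r ^ k) * gauss r = radialMoment k :=
    fun k => setLIntegral_congr_fun measurableSet_Ioi fun r (hr : 0 < r) => by
      simp only [ENNReal.ofReal_pow hr.le]
  have hmoment_succ : ∫⁻ r in Ioi (0 : ℝ), ENNReal.ofReal (r ^ n) * (‖r‖ₑ * gauss r) =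
      radialMoment (n + 1) := setLIntegral_congr_fun measurableSet_Ioi fun r (hr : 0 < r) => by
    simp only [ENNReal.ofReal_pow hr.le, Real.enorm_of_nonneg hr.le, ← mul_assoc, pow_succ]
  simp only [gauss_congr_norm (norm_norm _), enorm_norm, lintegral_gauss, hn,
    Nat.add_sub_cancel, hmoment, hmoment_succ] at hmass hnorm ⊢
  rw [hnorm, mul_left_comm, mul_comm, mul_right_comm, mul_comm, mul_comm (radialMoment n),
    ← hmass, mul_one]

/-- The determinant of a family of vectors of `E n` with respect to the standard basis. -/
noncomputable def stdDet (n : ℕ) : E n [⋀^Fin n]→ₗ[ℝ] ℝ :=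
  (EuclideanSpace.basisFun (Fin n) ℝ).toBasis.det

theorem stdDet_apply {n : ℕ} (y : Fin n → E n) :
    stdDet n y = Matrix.det (Matrix.of fun i j => y i j) := by
  rw [stdDet, Basis.det_apply, ← Matrix.det_transpose]
  rfl

theorem stdDet_map {n : ℕ} (f : E n →ₗ[ℝ] E n) (y : Fin n → E n) :
    stdDet n (fun i => f (y i)) = LinearMap.det f * stdDet n y :=
  (EuclideanSpace.basisFun (Fin n) ℝ).toBasis.det_comp f y

theorem stdDet_ne_zero_iff {n : ℕ} {y : Fin n → E n} :
    stdDet n y ≠ 0 ↔ LinearIndependent ℝ y := by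
  rw [stdDet, ← isUnit_iff_ne_zero, ← Basis.is_basis_iff_det]
  exact ⟨And.left, fun h => ⟨h, h.span_eq_top_of_card_eq_finrank' (by simp)⟩⟩

@[fun_prop]
theorem continuous_stdDet {n : ℕ} : Continuous (stdDet n : (Fin n → E n) → ℝ) := by
  simp only [funext stdDet_apply]
  exact Continuous.matrix_det (by fun_prop)

@[fun_prop]
theorem measurable_stdDet {n : ℕ} : Measurable (stdDet n : (Fin n → E n) → ℝ) :=
  continuous_stdDet.measurable

theorem enorm_stdDet_linearIsometryEquiv {n : ℕ} (R : E n ≃ₗᵢ[ℝ] E n) (y : Fin n → E n) :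
    ‖stdDet n fun i => R (y i)‖ₑ = ‖stdDet n y‖ₑ := by
  have hR : |LinearMap.det R.toLinearEquiv.toLinearMap| = 1 := by
    rw [← LinearMap.normDet_eq_abs_det]
    exact R.toLinearIsometry.normDet_eq_one
  have h := stdDet_map R.toLinearEquiv.toLinearMap y
  exact enorm_eq_iff_norm_eq.2 (by
    rw [← one_mul ‖stdDet n y‖, ← hR, ← Real.norm_eq_abs, ← norm_mul, ← h]; rfl)

/-- The vector of `E (n + 1)` with first coordinate `t` and remaining coordinates `v`. -/
noncomputable def consCoord {n : ℕ} (t : ℝ) (v : E n) : E (n + 1) :=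
  WithLp.toLp 2 (Fin.cons t (WithLp.ofLp v))

theorem gauss_consCoord {n : ℕ} (t : ℝ) (v : E n) :
    gauss (consCoord t v) = gauss t * gauss v := by
  rw [gauss, gauss, gauss, ← ENNReal.ofReal_mul (Real.exp_pos _).le, ← Real.exp_add,
    EuclideanSpace.norm_sq_eq, EuclideanSpace.norm_sq_eq, Fin.sum_univ_succ]
  congr 2
  simp only [consCoord, Fin.cons_zero, Fin.cons_succ]
  ring

theorem stdDet_cons_single {n : ℕ} (c : ℝ) (t : Fin n → ℝ) (z : Fin n → E n) :
    stdDet (n + 1) (Fin.cons (EuclideanSpace.single 0 c) fun i => consCoord (t i) (z i)) =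
      c * stdDet n z := by
  rw [stdDet_apply, Matrix.det_succ_row_zero, Finset.sum_eq_single 0 (by simp +contextual)
    (by simp)]
  simp [stdDet_apply, consCoord, Matrix.submatrix]

theorem measurePreserving_consCoord (n m : ℕ) :
    MeasurePreserving fun (p : (Fin m → ℝ) × (Fin m → E n)) i => consCoord (p.1 i) (p.2 i) := by
  have h : MeasurePreserving fun p : ℝ × E n => consCoord p.1 p.2 :=
    (PiLp.volume_preserving_toLp (Fin (n + 1))).comp ((measurePreserving_cons n ℝ).comp
      ((MeasurePreserving.id volume).prod (PiLp.volume_preserving_ofLp (Fin n))))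
  exact (volume_preserving_pi fun _ : Fin m => h).comp
    (volume_measurePreserving_arrowProdEquivProdArrow ℝ (E n) (Fin m)).symm

/-- The Gaussian integral of the absolute value of the determinant of `n` vectors of `E n`. -/
noncomputable def detMoment (n : ℕ) : ℝ≥0∞ :=
  ∫⁻ y : Fin n → E n, ‖stdDet n y‖ₑ * ∏ i, gauss (y i)

theorem lintegral_enorm_stdDet_cons_single {n : ℕ} (c : ℝ) :
    ∫⁻ y : Fin n → E (n + 1),
      ‖stdDet (n + 1) (Fin.cons (EuclideanSpace.single 0 c) y)‖ₑ * ∏ i, gauss (y i) =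
      ‖c‖ₑ * detMoment n := by
  rw [← (measurePreserving_consCoord n n).lintegral_comp (by fun_prop)]
  calc _ = ∫⁻ p : (Fin n → ℝ) × (Fin n → E n),
          (∏ i, gauss (p.1 i)) * (‖c‖ₑ * (‖stdDet n p.2‖ₑ * ∏ i, gauss (p.2 i))) := by
        refine lintegral_congr fun p => ?_
        simp only [stdDet_cons_single, gauss_consCoord, Finset.prod_mul_distrib, enorm_mul]
        ring
    _ = ‖c‖ₑ * detMoment n := by
        rw [Measure.volume_eq_prod, lintegral_prod_mul (f := fun x : Fin n → ℝ => ∏ i, gauss (x i))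
          (g := fun y : Fin n → E n => ‖c‖ₑ * (‖stdDet n y‖ₑ * ∏ i, gauss (y i)))
          (Measurable.aemeasurable (by fun_prop)) (Measurable.aemeasurable (by fun_prop)),
          lintegral_pi_prod_eq_pow measurable_gauss, lintegral_gauss, one_pow,
          one_mul, lintegral_const_mul _ (by fun_prop), detMoment]

theorem lintegral_enorm_stdDet_cons {n : ℕ} (v : E (n + 1)) :
    ∫⁻ y : Fin n → E (n + 1), ‖stdDet (n + 1) (Fin.cons v y)‖ₑ * ∏ i, gauss (y i) =
      ‖v‖ₑ * detMoment n := by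
  set w : E (n + 1) := EuclideanSpace.single 0 ‖v‖
  let R : E (n + 1) ≃ₗᵢ[ℝ] E (n + 1) := (ℝ ∙ (v - w))ᗮ.reflection
  have hR : R v = w := Submodule.reflection_sub (by simp [w])
  have hdet : ∀ y : Fin n → E (n + 1),
      ‖stdDet (n + 1) (Fin.cons v y)‖ₑ = ‖stdDet (n + 1) (Fin.cons w fun i => R (y i))‖ₑ := by
    intro y
    rw [← enorm_stdDet_linearIsometryEquiv R]
    congr 2
    exact funext <| Fin.cases hR fun i => rfl
  have hgauss : ∀ x, gauss x = gauss (R x) := fun x => gauss_congr_norm (R.norm_map x).symm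
  calc _ = ∫⁻ y : Fin n → E (n + 1),
          ‖stdDet (n + 1) (Fin.cons w fun i => R (y i))‖ₑ * ∏ i, gauss (R (y i)) :=
        lintegral_congr fun y => by simp only [hdet, ← hgauss]
    _ = _ := by
        rw [(volume_preserving_pi fun _ : Fin n => R.measurePreserving).lintegral_comp
            (f := fun y => ‖stdDet (n + 1) (Fin.cons w y)‖ₑ * ∏ i, gauss (y i)) (by fun_prop),
          lintegral_enorm_stdDet_cons_single, enorm_norm]

theorem detMoment_succ (n : ℕ) :
    detMoment (n + 1) = (∫⁻ v : E (n + 1), ‖v‖ₑ * gauss v) * detMoment n := by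
  have : SigmaFinite (volume : Measure (E (n + 1))) := inferInstance
  have hcons := measurePreserving_cons n (E (n + 1))
  rw [detMoment, ← hcons.lintegral_comp (by fun_prop),
    Measure.volume_eq_prod, lintegral_prod _ (Measurable.aemeasurable (by fun_prop)),
    ← lintegral_mul_const _ (by fun_prop)]
  refine lintegral_congr fun v => ?_
  rw [mul_right_comm, ← lintegral_enorm_stdDet_cons, ← lintegral_mul_const _ (by fun_prop)]
  refine lintegral_congr fun y => ?_
  simp only [Fin.prod_univ_succ, Fin.cons_zero, Fin.cons_succ]
  ring

theorem detMoment_eq (n : ℕ) : detMoment n = 2 * radialMoment n := by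
  induction n with
  | zero => simp [detMoment, stdDet_apply, volume_pi, two_mul_radialMoment_zero]
  | succ n ih =>
    rw [detMoment_succ, ih, mul_left_comm, mul_comm _ (radialMoment n)]
    simpa using congrArg (2 * ·) (radialMoment_mul_lintegral_enorm_mul_gauss (E (n + 1)))

end GaussianDeterminant

section SimplicialCones

variable {ι V : Type*} [Fintype ι] [NormedAddCommGroup V] [InnerProductSpace ℝ V] {y : ι → V}
  {u : V}

/-- The linearly independent families `y` whose open simplicial cone, the set of all combinations
`∑ i, c i • y i` with `c i > 0`, contains `u`. -/
def coneFamilies (ι : Type*) [Fintype ι] {V : Type*} [AddCommGroup V] [Module ℝ V] (u : V) :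
    Set (ι → V) :=
  {y | LinearIndependent ℝ y ∧ ∃ c : ι → ℝ, (∀ i, 0 < c i) ∧ ∑ i, c i • y i = u}

theorem smul_mem_coneFamilies_iff (hy : LinearIndependent ℝ y) {c : ι → ℝ}
    (hc : ∑ i, c i • y i = u) {t : ι → ℝ} (ht : ∀ i, t i ≠ 0) :
    (fun i => t i • y i) ∈ coneFamilies ι u ↔ ∀ i, 0 < t i * c i := by
  constructor
  · rintro ⟨-, c', hc', hu⟩ i
    have h : c' i * t i = c i := by
      refine Fintype.linearIndependent_iffₛ.1 hy (fun i => c' i * t i) c ?_ i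
      simpa only [mul_smul, hu] using hc.symm
    have : 0 < c' i * (t i * t i) := mul_pos (hc' i) (mul_self_pos.2 (ht i))
    rwa [← h, mul_left_comm]
  · intro h
    refine ⟨hy.units_smul fun i => Units.mk0 (t i) (ht i), fun i => c i / t i, fun i => ?_, ?_⟩
    · have := div_pos (h i) (mul_self_pos.2 (ht i))
      rwa [mul_div_mul_left _ _ (ht i)] at this
    · simp only [smul_smul, div_mul_cancel₀ _ (ht _), hc]

theorem smul_mem_coneFamilies {t : ι → ℝ} (ht : ∀ i, 0 < t i) (hy : y ∈ coneFamilies ι u) :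
    (fun i => t i • y i) ∈ coneFamilies ι u := by
  obtain ⟨hli, c, hc, hu⟩ := hy
  exact (smul_mem_coneFamilies_iff hli hu fun i => (ht i).ne').2 fun i => mul_pos (ht i) (hc i)

theorem norm_le_norm_sub_iff {v w : V} : ‖v‖ ≤ ‖v - w‖ ↔ 2 * ⟪w, v⟫ ≤ ‖w‖ ^ 2 := by
  rw [← sq_le_sq₀ (norm_nonneg _) (norm_nonneg _), norm_sub_sq_real, real_inner_comm]
  constructor <;> intro h <;> linarith

theorem norm_sub_eq_norm_iff {v w : V} : ‖v - w‖ = ‖v‖ ↔ 2 * ⟪w, v⟫ = ‖w‖ ^ 2 := by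
  rw [← sq_eq_sq₀ (norm_nonneg _) (norm_nonneg _), norm_sub_sq_real, real_inner_comm]
  constructor <;> intro h <;> linarith

section FiniteDimensional

variable [FiniteDimensional ℝ V]

theorem exists_forall_inner_eq (hy : LinearIndependent ℝ y) (hcard : Fintype.card ι = finrank ℝ V)
    (a : ι → ℝ) : ∃ v, ∀ i, ⟪v, y i⟫ = a i := by
  obtain ⟨b, hb⟩ : ∃ b : Basis ι ℝ V, ⇑b = y :=
    ⟨.mk hy (hy.span_eq_top_of_card_eq_finrank' hcard).ge, Basis.coe_mk _ _⟩
  refine ⟨(InnerProductSpace.toDual ℝ V).symm (b.constr ℝ a).toContinuousLinearMap, fun i => ?_⟩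
  rw [InnerProductSpace.toDual_symm_apply, ← hb]
  exact b.constr_basis ℝ a i

theorem eq_of_forall_inner_eq (hy : LinearIndependent ℝ y) (hcard : Fintype.card ι = finrank ℝ V)
    {v w : V} (h : ∀ i, ⟪v, y i⟫ = ⟪w, y i⟫) : v = w :=
  InnerProductSpace.ext_inner_right_basis
    (Basis.mk hy (hy.span_eq_top_of_card_eq_finrank' hcard).ge) fun i => by simpa using h i

theorem mem_coneFamilies_iff_forall_inner_neg (hcard : Fintype.card ι = finrank ℝ V) :
    y ∈ coneFamilies ι u ↔ ∀ v ≠ 0, (∀ i, ⟪v, y i⟫ ≤ 0) → ⟪v, u⟫ < 0 := by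
  constructor
  · rintro ⟨hy, c, hc, rfl⟩ v hv hle
    obtain ⟨j, hj⟩ : ∃ j, ⟪v, y j⟫ ≠ 0 := by
      by_contra! h
      exact hv (eq_of_forall_inner_eq hy hcard (by simpa using h))
    rw [inner_sum]
    simp only [inner_smul_right]
    exact Finset.sum_neg' (fun i _ => mul_nonpos_of_nonneg_of_nonpos (hc i).le (hle i))
      ⟨j, Finset.mem_univ j, mul_neg_of_pos_of_neg (hc j) ((hle j).lt_of_ne hj)⟩
  · classical
    intro h
    have hspan : Submodule.span ℝ (range y) = ⊤ := by
      rw [← Submodule.orthogonal_eq_bot_iff, Submodule.eq_bot_iff]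
      intro v hv
      by_contra hv0
      have hvy : ∀ i, ⟪v, y i⟫ = 0 := fun i =>
        Submodule.inner_left_of_mem_orthogonal (Submodule.subset_span (mem_range_self i)) hv
      have h1 := h v hv0 fun i => (hvy i).le
      have h2 := h (-v) (neg_ne_zero.2 hv0) fun i => by simp [hvy]
      rw [inner_neg_left] at h2
      linarith
    have hy : LinearIndependent ℝ y :=
      linearIndependent_of_top_le_span_of_card_eq_finrank hspan.ge hcard
    obtain ⟨c, rfl⟩ : ∃ c : ι → ℝ, ∑ i, c i • y i = u :=
      (Submodule.mem_span_range_iff_exists_fun ℝ).1 (hspan ▸ Submodule.mem_top)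
    refine ⟨hy, c, fun i => ?_, rfl⟩
    obtain ⟨v, hv⟩ := exists_forall_inner_eq hy hcard (-Pi.single i 1)
    have hv0 : v ≠ 0 := by
      rintro rfl
      simpa using hv i
    have := h v hv0 fun j => by
      rw [hv, Pi.neg_apply, Pi.single_apply]
      split_ifs <;> norm_num
    simpa [inner_sum, inner_smul_right, hv, Pi.single_apply] using this

theorem exists_pos_forall_inner_neg (hcard : Fintype.card ι = finrank ℝ V)
    (hy : y ∈ coneFamilies ι u) :
    ∃ κ > 0, ∀ v ≠ 0, (∀ i, ⟪v, y i⟫ ≤ κ * ‖v‖) → ⟪v, u⟫ < 0 := by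
  rw [mem_coneFamilies_iff_forall_inner_neg hcard] at hy
  have hcompact : IsCompact (sphere (0 : V) 1 ∩ {w | 0 ≤ ⟪w, u⟫}) :=
    (isCompact_sphere 0 1).inter_right (isClosed_le continuous_const (by fun_prop))
  have hpos : ∀ w ∈ sphere (0 : V) 1 ∩ {w | 0 ≤ ⟪w, u⟫}, 0 < ∑ i, max ⟪w, y i⟫ 0 := by
    rintro w ⟨hw1, hw2 : 0 ≤ ⟪w, u⟫⟩
    contrapose! hw2
    refine hy w (ne_of_mem_sphere hw1 one_ne_zero) fun i => (le_max_left _ 0).trans ?_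
    exact (Finset.single_le_sum (f := fun i => max ⟪w, y i⟫ 0) (fun i _ => le_max_right _ _)
      (Finset.mem_univ i)).trans hw2
  obtain ⟨a, ha, hle⟩ := hcompact.exists_forall_le'
    (Continuous.continuousOn (by fun_prop)) hpos
  refine ⟨a / (Fintype.card ι + 1), by positivity, fun v hv hv' => ?_⟩
  by_contra! hu
  have hv0 : 0 < ‖v‖ := norm_pos_iff.2 hv
  have hsum : a ≤ ∑ i, max ⟪‖v‖⁻¹ • v, y i⟫ 0 := by
    refine hle _ ⟨?_, ?_⟩
    · simp [norm_smul, hv]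
    · rw [mem_ofPred_eq, real_inner_smul_left]
      positivity
  have hmax : ∀ i, max ⟪‖v‖⁻¹ • v, y i⟫ 0 ≤ a / (Fintype.card ι + 1) := fun i => by
    refine max_le ?_ (by positivity)
    rw [real_inner_smul_left, inv_mul_le_iff₀ hv0, mul_comm]
    exact hv' i
  have := hsum.trans (Finset.sum_le_card_nsmul _ _ _ fun i _ => hmax i)
  rw [nsmul_eq_mul, Finset.card_univ, mul_div_assoc', le_div_iff₀ (by positivity)] at this
  linarith

/-- A point is lower than its neighbours outside the open balls that have it on their boundary
exactly when the directions to the centres span a cone around the downward direction. -/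
theorem mem_coneFamilies_iff_local (hcard : Fintype.card ι = finrank ℝ V) :
    y ∈ coneFamilies ι u ↔
      ∃ δ > 0, ∀ v, ‖v‖ < δ → v ≠ 0 → (∀ i, ‖y i‖ ≤ ‖y i - v‖) → ⟪v, u⟫ < 0 := by
  simp only [norm_le_norm_sub_iff]
  constructor
  · intro hy
    obtain ⟨κ, hκ, h⟩ := exists_pos_forall_inner_neg hcard hy
    refine ⟨2 * κ, by positivity, fun v hv hv0 hle => h v hv0 fun i => ?_⟩
    nlinarith [hle i, norm_nonneg v]
  · rintro ⟨δ, hδ, h⟩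
    refine (mem_coneFamilies_iff_forall_inner_neg hcard).2 fun v hv hle => ?_
    have hv0 : 0 < ‖v‖ := norm_pos_iff.2 hv
    have ht : 0 < δ / (2 * ‖v‖) := div_pos hδ (mul_pos two_pos hv0)
    have := h ((δ / (2 * ‖v‖)) • v) ?_ (smul_ne_zero ht.ne' hv) fun i => ?_
    · rw [real_inner_smul_left] at this
      exact (pos_iff_neg_of_mul_neg this).1 ht
    · rw [norm_smul, Real.norm_of_nonneg ht.le]
      field_simp
      linarith
    · rw [real_inner_smul_left]
      have := mul_nonpos_of_nonneg_of_nonpos ht.le (hle i)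
      linarith [sq_nonneg ‖(δ / (2 * ‖v‖)) • v‖]

theorem exists_setOf_norm_sub_eq_norm [Nonempty ι] (hcard : Fintype.card ι = finrank ℝ V)
    (hy : y ∈ coneFamilies ι u) : ∃ w, 0 < ⟪w, u⟫ ∧ {v | ∀ i, ‖y i - v‖ = ‖y i‖} = {0, w} := by
  obtain ⟨hli, c, hc, rfl⟩ := hy
  obtain ⟨n, hn⟩ := exists_forall_inner_eq hli hcard 1
  have hn0 : 0 < ‖n‖ := norm_pos_iff.2 fun h => by simpa [h] using hn (Classical.arbitrary ι)
  have hnorm : ∀ v : V, ∀ i, ‖y i - v‖ = ‖y i‖ ↔ ⟪v, y i⟫ = ⟪(‖v‖ ^ 2 / 2) • n, y i⟫ := by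
    intro v i
    rw [norm_sub_eq_norm_iff, real_inner_smul_left, hn, Pi.one_apply]
    constructor <;> intro h <;> linarith
  refine ⟨(2 / ‖n‖ ^ 2) • n, ?_, ?_⟩
  · simp only [real_inner_smul_left, inner_sum, inner_smul_right, hn, Pi.one_apply, mul_one]
    exact Finset.sum_pos (fun i _ => mul_pos (hc i) (by positivity)) Finset.univ_nonempty
  · ext v
    simp only [mem_ofPred_eq, hnorm, mem_insert_iff, mem_singleton_iff]
    constructor
    · intro h
      obtain ⟨t, rfl⟩ : ∃ t : ℝ, v = t • n := ⟨_, eq_of_forall_inner_eq hli hcard h⟩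
      have ht := h (Classical.arbitrary ι)
      simp only [real_inner_smul_left, hn, Pi.one_apply, norm_smul, mul_pow, Real.norm_eq_abs,
        sq_abs, mul_one] at ht
      rcases eq_or_ne t 0 with rfl | h0
      · exact .inl (zero_smul ℝ n)
      · refine .inr (congrArg (· • n) ?_)
        field_simp at ht ⊢
        linarith
    · rintro (rfl | rfl) i
      · simp
      · rw [norm_smul, Real.norm_of_nonneg (by positivity)]
        congr 2
        field_simp

theorem eq_of_sub_mem_coneFamilies [Nonempty ι] (hcard : Fintype.card ι = finrank ℝ V)
    {x : ι → V} {p q : V}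
    (hp : (fun i => x i - p) ∈ coneFamilies ι u) (hq : (fun i => x i - q) ∈ coneFamilies ι u)
    (h : ∀ i, ‖x i - p‖ = ‖x i - q‖) : p = q := by
  have key : ∀ {p q : V}, (fun i => x i - p) ∈ coneFamilies ι u →
      (∀ i, ‖x i - q‖ = ‖x i - p‖) → p ≠ q → 0 < ⟪q - p, u⟫ := by
    intro p q hp h hne
    obtain ⟨w, hw, hset⟩ := exists_setOf_norm_sub_eq_norm hcard hp
    have : q - p ∈ ({0, w} : Set V) := hset ▸ fun i => by simpa using h i
    rcases this with h0 | rfl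
    · exact absurd (sub_eq_zero.1 h0).symm hne
    · exact hw
  by_contra hne
  have h1 := key hp (fun i => (h i).symm) hne
  have h2 := key hq h (Ne.symm hne)
  rw [← neg_sub, inner_neg_left] at h2
  linarith

end FiniteDimensional

end SimplicialCones

section SignSymmetry

variable {n : ℕ}

theorem finite_setOf_stdDet_add_smul_eq_zero {v : Fin n → E n} (hv : LinearIndependent ℝ v)
    (y : Fin n → E n) : {t : ℝ | stdDet n (y + t • v) = 0}.Finite := by
  obtain ⟨f, hfv⟩ : ∃ f : E n →ₗ[ℝ] E n, ∀ i, f (v i) = -y i := by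
    obtain ⟨b, rfl⟩ : ∃ b : Basis (Fin n) ℝ (E n), ⇑b = v :=
      ⟨.mk hv (hv.span_eq_top_of_card_eq_finrank' (by simp)).ge, Basis.coe_mk _ _⟩
    exact ⟨b.constr ℝ (-y), b.constr_basis ℝ (-y)⟩
  have hf : ∀ t : ℝ, stdDet n (y + t • v) = f.charpoly.eval t * stdDet n v := by
    intro t
    rw [LinearMap.eval_charpoly, ← stdDet_map]
    congr 1
    ext1 i
    simp [hfv, add_comm]
  refine (f.charpoly.rootSet_finite ℝ).subset fun t ht => ?_
  rw [Polynomial.mem_rootSet_of_ne f.charpoly_monic.ne_zero, Polynomial.coe_aeval_eq_eval]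
  exact (mul_eq_zero.1 ((hf t).symm.trans ht)).resolve_right (stdDet_ne_zero_iff.2 hv)

theorem ae_of_forall_line_finite {F : Type*} [NormedAddCommGroup F] [NormedSpace ℝ F]
    [FiniteDimensional ℝ F] [MeasurableSpace F] [BorelSpace F] (μ : Measure F)
    [μ.IsAddHaarMeasure] {f : F → ℝ} (hf : Measurable f) (v : F)
    (h : ∀ y, {t : ℝ | f (y + t • v) = 0}.Finite) : ∀ᵐ y ∂μ, f y ≠ 0 :=
  ae_mem_of_ae_add_linearMap_mem (LinearMap.toSpanSingleton ℝ F v) volume μ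
    (hf (measurableSet_singleton 0).compl) fun y => (h y).countable.ae_notMem volume

theorem ae_linearIndependent : ∀ᵐ y : Fin n → E n, LinearIndependent ℝ y := by
  simp only [← stdDet_ne_zero_iff]
  exact ae_of_forall_line_finite _ measurable_stdDet _ <|
    finite_setOf_stdDet_add_smul_eq_zero
      (EuclideanSpace.basisFun (Fin n) ℝ).toBasis.linearIndependent

theorem exists_linearIndependent_apply_eq {u : E n} (hu : u ≠ 0) (i : Fin n) :
    ∃ v : Fin n → E n, LinearIndependent ℝ v ∧ v i = u := by
  let e : Fin n → E n := fun j => ‖u‖ • EuclideanSpace.basisFun (Fin n) ℝ j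
  have he : LinearIndependent ℝ e :=
    (EuclideanSpace.basisFun (Fin n) ℝ).toBasis.linearIndependent.units_smul
      fun _ => Units.mk0 ‖u‖ (norm_ne_zero_iff.2 hu)
  let R : E n ≃ₗᵢ[ℝ] E n := (ℝ ∙ (e i - u))ᗮ.reflection
  exact ⟨R ∘ e, he.map' R.toLinearEquiv.toLinearMap R.toLinearEquiv.ker,
    Submodule.reflection_sub (by simp [e, norm_smul])⟩

theorem ae_stdDet_update_ne_zero {u : E n} (hu : u ≠ 0) (i : Fin n) :
    ∀ᵐ y : Fin n → E n, stdDet n (Function.update y i u) ≠ 0 := by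
  obtain ⟨v, hv, hvi⟩ := exists_linearIndependent_apply_eq hu i
  refine ae_of_forall_line_finite _ (by fun_prop) v fun y => ?_
  refine (finite_setOf_stdDet_add_smul_eq_zero hv (Function.update y i 0)).subset fun t ht => ?_
  have : Function.update y i 0 + t • v = Function.update (y + t • v) i (t • u) := by
    ext1 j
    rcases eq_or_ne j i with rfl | hj <;> simp [*]
  rw [mem_ofPred_eq, this, (stdDet n).map_update_smul, show stdDet n _ = 0 from ht, smul_zero]

theorem stdDet_update_sum (y : Fin n → E n) (c : Fin n → ℝ) (i : Fin n) :
    stdDet n (Function.update y i (∑ j, c j • y j)) = c i * stdDet n y := by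
  rw [(stdDet n).map_update_sum, Finset.sum_eq_single i]
  · rw [(stdDet n).map_update_smul, Function.update_eq_self, smul_eq_mul]
  · intro j _ hj
    rw [(stdDet n).map_update_smul, (stdDet n).map_update_self _ hj.symm, smul_zero]
  · simp

theorem exists_sum_smul_eq {y : Fin n → E n} (hy : LinearIndependent ℝ y) (u : E n) :
    ∃ c : Fin n → ℝ, ∑ i, c i • y i = u :=
  (Submodule.mem_span_range_iff_exists_fun ℝ).1 <|
    (hy.span_eq_top_of_card_eq_finrank' (by simp)) ▸ Submodule.mem_top

theorem mem_coneFamilies_iff_stdDet [NeZero n] {u : E n} {y : Fin n → E n} :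
    y ∈ coneFamilies (Fin n) u ↔ ∀ i, 0 < stdDet n y * stdDet n (Function.update y i u) := by
  constructor
  · rintro ⟨hy, c, hc, rfl⟩ i
    rw [stdDet_update_sum, mul_left_comm]
    exact mul_pos (hc i) (mul_self_pos.2 (stdDet_ne_zero_iff.2 hy))
  · intro h
    have hy : LinearIndependent ℝ y := stdDet_ne_zero_iff.1 (left_ne_zero_of_mul (h 0).ne')
    obtain ⟨c, rfl⟩ := exists_sum_smul_eq hy u
    refine ⟨hy, c, fun i => ?_, rfl⟩
    have := h i
    rw [stdDet_update_sum, mul_left_comm] at this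
    exact pos_of_mul_pos_left this (mul_self_nonneg _)

theorem isOpen_coneFamilies [NeZero n] (u : E n) : IsOpen (coneFamilies (Fin n) u) := by
  have : coneFamilies (Fin n) u =
      ⋂ i, {y | 0 < stdDet n y * stdDet n (Function.update y i u)} := by
    ext y
    simp [mem_coneFamilies_iff_stdDet]
  exact this ▸ isOpen_iInter_of_finite fun i => isOpen_lt continuous_const (by fun_prop)

theorem ae_linearIndependent_and_sum_smul_eq {u : E n} (hu : u ≠ 0) :
    ∀ᵐ y : Fin n → E n,
      LinearIndependent ℝ y ∧ ∃ c : Fin n → ℝ, (∀ i, c i ≠ 0) ∧ ∑ i, c i • y i = u := by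
  filter_upwards [ae_linearIndependent, ae_all_iff.2 (ae_stdDet_update_ne_zero hu)] with y hy h
  obtain ⟨c, rfl⟩ := exists_sum_smul_eq hy u
  refine ⟨hy, c, fun i hi => h i ?_, rfl⟩
  rw [stdDet_update_sum, hi, zero_mul]

/-- The action of a choice of signs on families of vectors. -/
def signFlip (ε : Fin n → ℤˣ) (y : Fin n → E n) : Fin n → E n := fun i => ((ε i : ℤ) : ℝ) • y i

theorem abs_unit (ε : ℤˣ) : |((ε : ℤ) : ℝ)| = 1 := by
  rcases Int.units_eq_one_or ε with rfl | rfl <;> simp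

theorem measurePreserving_signFlip (ε : Fin n → ℤˣ) : MeasurePreserving (signFlip ε) := by
  refine volume_preserving_pi fun i => ?_
  rcases Int.units_eq_one_or (ε i) with h | h
  · convert! MeasurePreserving.id (volume : Measure (E n)) using 1
    ext1 v
    simp [h]
  · convert! Measure.measurePreserving_neg (volume : Measure (E n)) using 1
    ext1 v
    simp [h]

theorem sum_indicator_signFlip {u : E n} {y : Fin n → E n} (hy : LinearIndependent ℝ y)
    {c : Fin n → ℝ} (hc : ∀ i, c i ≠ 0) (hu : ∑ i, c i • y i = u) (a : ℝ≥0∞) :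
    ∑ ε : Fin n → ℤˣ, (signFlip ε ⁻¹' coneFamilies (Fin n) u).indicator (fun _ => a) y = a := by
  classical
  have hmem : ∀ ε : Fin n → ℤˣ, signFlip ε y ∈ coneFamilies (Fin n) u ↔
      ε = fun i => if 0 < c i then 1 else -1 := by
    intro ε
    rw [funext_iff]
    refine (smul_mem_coneFamilies_iff hy hu fun i => by simp).trans (forall_congr' fun i => ?_)
    rcases Int.units_eq_one_or (ε i) with h | h <;> rcases (hc i).lt_or_gt with h' | h' <;>
      simp [h, h', h'.not_gt]
  rw [Finset.sum_eq_single fun i => if 0 < c i then 1 else -1]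
  · exact if_pos ((hmem _).2 rfl)
  · exact fun ε _ hε => if_neg (mt (hmem ε).1 hε)
  · simp

/-- Almost every family has exactly one choice of signs that moves it into `coneFamilies`. -/
theorem lintegral_eq_two_pow_mul_setLIntegral_coneFamilies [NeZero n] {u : E n} (hu : u ≠ 0)
    {F : (Fin n → E n) → ℝ≥0∞} (hF : Measurable F) (hsymm : ∀ ε y, F (signFlip ε y) = F y) :
    ∫⁻ y, F y = 2 ^ n * ∫⁻ y in coneFamilies (Fin n) u, F y := by
  have hms : MeasurableSet (coneFamilies (Fin n) u) := (isOpen_coneFamilies u).measurableSet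
  calc ∫⁻ y, F y
      = ∫⁻ y, ∑ ε : Fin n → ℤˣ, (coneFamilies (Fin n) u).indicator F (signFlip ε y) := by
        refine lintegral_congr_ae ?_
        filter_upwards [ae_linearIndependent_and_sum_smul_eq hu] with y ⟨hy, c, hc, hcu⟩
        rw [← sum_indicator_signFlip hy hc hcu (F y)]
        refine Finset.sum_congr rfl fun ε _ => ?_
        by_cases hε : signFlip ε y ∈ coneFamilies (Fin n) u <;> simp [indicator, hε, hsymm]
    _ = ∑ ε : Fin n → ℤˣ, ∫⁻ y, (coneFamilies (Fin n) u).indicator F (signFlip ε y) :=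
        lintegral_finsetSum _ fun ε _ =>
          (hF.indicator hms).comp (measurePreserving_signFlip ε).measurable
    _ = ∑ _ε : Fin n → ℤˣ, ∫⁻ y in coneFamilies (Fin n) u, F y :=
        Finset.sum_congr rfl fun ε _ => by
          rw [(measurePreserving_signFlip ε).lintegral_comp (hF.indicator hms),
            lintegral_indicator hms]
    _ = 2 ^ n * ∫⁻ y in coneFamilies (Fin n) u, F y := by simp

theorem detMoment_eq_two_pow_mul_setLIntegral [NeZero n] {u : E n} (hu : u ≠ 0) :
    detMoment n =
      2 ^ n * ∫⁻ y in coneFamilies (Fin n) u, ‖stdDet n y‖ₑ * ∏ i, gauss (y i) := by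
  refine lintegral_eq_two_pow_mul_setLIntegral_coneFamilies hu (by fun_prop) fun ε y => ?_
  have hnorm : ∀ i, ‖signFlip ε y i‖ = ‖y i‖ := fun i => by
    rw [signFlip, norm_smul, Real.norm_eq_abs, abs_unit, one_mul]
  have hdet : ‖stdDet n (signFlip ε y)‖ = ‖stdDet n y‖ := by
    have := (stdDet n).map_smul_univ (fun i => ((ε i : ℤ) : ℝ)) y
    rw [show signFlip ε y = fun i => ((ε i : ℤ) : ℝ) • y i from rfl, this, norm_smul, norm_prod]
    simp [abs_unit]
  rw [enorm_eq_iff_norm_eq.2 hdet]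
  simp only [gauss_congr_norm (hnorm _)]

end SignSymmetry

section Determinants

variable {K W : Type*} [Field K] [AddCommGroup W] [Module K W] [FiniteDimensional K W]

theorem det_id_add_of_comp_self_eq_zero {g : W →ₗ[K] W} (hg : g ∘ₗ g = 0) :
    LinearMap.det (LinearMap.id + g) = 1 := by
  have hnil : IsNilpotent (-g : Module.End K W) := ⟨2, by rw [neg_sq, pow_two]; exact hg⟩
  have h := LinearMap.eval_charpoly (-g) 1
  rw [hnil.charpoly_eq_X_pow_finrank, Polynomial.eval_pow, Polynomial.eval_X, one_pow, map_one,
    sub_neg_eq_add] at h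
  exact h.symm

theorem det_smul_id_add_smulRight {k : K} (hk : k ≠ 0) {f : Dual K W} {v : W} (hfv : f v = 1) :
    LinearMap.det (k • LinearMap.id + (1 - k) • f.smulRight v) = k ^ (finrank K W - 1) := by
  have h : k • LinearMap.id + (1 - k) • f.smulRight v =
      k • LinearMap.transvection f (((1 - k) / k) • v) := by
    ext w
    simp only [LinearMap.add_apply, LinearMap.smul_apply, LinearMap.id_apply,
      LinearMap.smulRight_apply, LinearMap.transvection.apply, smul_add, smul_smul]
    congr 2
    field_simp
  have : Nontrivial W := ⟨v, 0, fun hv => by simp [hv] at hfv⟩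
  obtain ⟨n, hn⟩ := Nat.exists_eq_add_one.2 (finrank_pos (R := K) (M := W))
  rw [h, LinearMap.det_smul, LinearMap.transvection.det, map_smul, hfv, smul_eq_mul, mul_one, hn,
    Nat.add_sub_cancel]
  field_simp
  ring

variable {ι : Type*} [Finite ι] {i₀ : ι} {T : (ι → W) →ₗ[K] (ι → W)}

theorem det_eq_one_of_apply_eq_add {f : ι → W →ₗ[K] W} (hf : f i₀ = 0)
    (hT : ∀ w i, T w i = w i + f i (w i₀)) : LinearMap.det T = 1 := by
  let g : (ι → W) →ₗ[K] (ι → W) := LinearMap.pi fun i => f i ∘ₗ LinearMap.proj i₀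
  have hg : g ∘ₗ g = 0 := LinearMap.ext fun w => funext fun i => by simp [g, hf]
  rw [show T = LinearMap.id + g from LinearMap.ext fun w => funext (hT w),
    det_id_add_of_comp_self_eq_zero hg]

theorem det_eq_of_apply_eq_update [DecidableEq ι] {U : (ι → W) →ₗ[K] W}
    (hT : ∀ w, T w = Function.update w i₀ (U w)) :
    LinearMap.det T = LinearMap.det (U ∘ₗ LinearMap.single K (fun _ => W) i₀) := by
  cases nonempty_fintype ι
  let g : ι → W →ₗ[K] W :=
    Function.update (fun _ => LinearMap.id) i₀ (U ∘ₗ LinearMap.single K (fun _ => W) i₀)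
  let P : (ι → W) →ₗ[K] (ι → W) := LinearMap.pi fun i => g i ∘ₗ LinearMap.proj i
  let N : (ι → W) →ₗ[K] (ι → W) := LinearMap.single K (fun _ => W) i₀ ∘ₗ U ∘ₗ
    (LinearMap.id - LinearMap.single K (fun _ => W) i₀ ∘ₗ LinearMap.proj i₀)
  have hN : N ∘ₗ N = 0 := LinearMap.ext fun w => by simp [N]
  have hTP : T = (LinearMap.id + N) ∘ₗ P := by
    refine LinearMap.ext fun w => ?_
    have hP : P w = Function.update w i₀ (U (Pi.single i₀ (w i₀))) := by
      ext i
      rcases eq_or_ne i i₀ with rfl | hi <;> simp [P, g, *]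
    have hw : P w - Pi.single i₀ (P w i₀) = w - Pi.single i₀ (w i₀) := by
      ext i
      rcases eq_or_ne i i₀ with rfl | hi <;> simp [*]
    have hNP : N (P w) = Pi.single i₀ (U w - U (Pi.single i₀ (w i₀))) := by
      rw [← map_sub, ← hw]
      rfl
    rw [LinearMap.comp_apply, LinearMap.add_apply, LinearMap.id_apply, hNP, hP, hT]
    ext i
    rcases eq_or_ne i i₀ with rfl | hi <;> simp [*]
  rw [hTP, LinearMap.det_comp, det_id_add_of_comp_self_eq_zero hN, one_mul, LinearMap.det_pi,
    Finset.prod_eq_single i₀]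
  · simp [g]
  · intro i _ hi
    simp [g, hi]
  · simp

theorem det_eq_of_apply_eq_sub (S : (ι → W) →ₗ[K] W) (f : ι → W →ₗ[K] W)
    (h₀ : ∀ w, T w i₀ = S w) (h : ∀ w, ∀ i ≠ i₀, T w i = w i - w i₀ - f i (S w)) :
    LinearMap.det T = LinearMap.det (S ∘ₗ LinearMap.pi fun _ => LinearMap.id) := by
  classical
  let shear (g : ι → W →ₗ[K] W) : (ι → W) →ₗ[K] (ι → W) :=
    LinearMap.pi fun i =>
      LinearMap.proj i + Function.update g i₀ 0 i ∘ₗ (LinearMap.proj i₀ : (ι → W) →ₗ[K] W)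
  have hshear : ∀ g, LinearMap.det (shear g) = 1 := fun g =>
    det_eq_one_of_apply_eq_add (Function.update_self i₀ 0 g) fun _ _ => rfl
  have hT : ∀ w, (shear f ∘ₗ T ∘ₗ shear fun _ => LinearMap.id) w =
      Function.update w i₀ ((S ∘ₗ shear fun _ => LinearMap.id) w) := by
    intro w
    ext i
    rcases eq_or_ne i i₀ with rfl | hi <;> simp [shear, *]
  have hS : (S ∘ₗ shear fun _ => LinearMap.id) ∘ₗ LinearMap.single K (fun _ => W) i₀ =
      S ∘ₗ LinearMap.pi fun _ => LinearMap.id := by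
    rw [LinearMap.comp_assoc]
    congr 1
    refine LinearMap.ext fun w => funext fun i => ?_
    rcases eq_or_ne i i₀ with rfl | hi <;> simp [shear, *]
  have := det_eq_of_apply_eq_update hT
  rwa [LinearMap.det_comp, LinearMap.det_comp, hshear, hshear, one_mul, mul_one, hS] at this

end Determinants

section Jacobian

section Normalize

variable {V : Type*} [NormedAddCommGroup V] [InnerProductSpace ℝ V] {v : V}

theorem norm_mul_inner_normalize (v w : V) : ‖v‖ * ⟪NormedSpace.normalize v, w⟫ = ⟪v, w⟫ := by
  rw [← real_inner_smul_left, NormedSpace.norm_smul_normalize]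

theorem hasFDerivAt_norm_of_ne_zero (hv : v ≠ 0) :
    HasFDerivAt (fun v : V => ‖v‖) (innerSL ℝ (NormedSpace.normalize v)) v := by
  have h := (hasStrictFDerivAt_norm_sq v).hasFDerivAt.sqrt (by positivity)
  simp only [Real.sqrt_sq (norm_nonneg _)] at h
  refine h.congr_fderiv (ContinuousLinearMap.ext fun w => ?_)
  have hn : ‖v‖ ≠ 0 := norm_ne_zero_iff.2 hv
  simp [← norm_mul_inner_normalize v w]
  field_simp

theorem hasFDerivAt_normalize (hv : v ≠ 0) :
    HasFDerivAt (NormedSpace.normalize : V → V)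
      (‖v‖⁻¹ • (ContinuousLinearMap.id ℝ V -
        (innerSL ℝ (NormedSpace.normalize v)).smulRight (NormedSpace.normalize v)))
      v := by
  have hn : ‖v‖ ≠ 0 := norm_ne_zero_iff.2 hv
  have h := ((hasDerivAt_inv hn).comp_hasFDerivAt v (hasFDerivAt_norm_of_ne_zero hv)).smul
    (hasFDerivAt_id v)
  refine h.congr_fderiv (ContinuousLinearMap.ext fun w => ?_)
  have hsq (a : ℝ) : ((‖v‖ ^ 2)⁻¹ * a) • v = (‖v‖⁻¹ * a) • NormedSpace.normalize v := by
    rw [NormedSpace.normalize, smul_smul]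
    congr 1
    field_simp
  simp [smul_smul, sub_eq_add_neg, hsq]

/-- The linear map that fixes the unit vector `e` and multiplies its orthogonal complement by
`k`. -/
noncomputable def orthDilation (k : ℝ) (e : V) : V →ₗ[ℝ] V :=
  k • LinearMap.id + (1 - k) • (innerₛₗ ℝ e).smulRight e

theorem inner_orthDilation (k : ℝ) {e : V} (he : ‖e‖ = 1) (w : V) :
    ⟪e, orthDilation k e w⟫ = ⟪e, w⟫ := by
  simp [orthDilation, inner_add_right, inner_smul_right, he]
  ring

end Normalize

variable {n : ℕ}

/-- The linear map `z ↦ (⟪y 1, z⟫, …, ⟪y n, z⟫)`. -/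
noncomputable def innerCoords (y : Fin n → E n) : E n →ₗ[ℝ] E n :=
  (WithLp.linearEquiv 2 ℝ (Fin n → ℝ)).symm.toLinearMap ∘ₗ LinearMap.pi fun j => innerₛₗ ℝ (y j)

theorem det_innerCoords (y : Fin n → E n) : LinearMap.det (innerCoords y) = stdDet n y := by
  rw [stdDet_apply,
    ← LinearMap.det_toMatrix (EuclideanSpace.basisFun (Fin n) ℝ).toBasis]
  congr 1
  ext i j
  simp [LinearMap.toMatrix_apply, innerCoords, EuclideanSpace.inner_single_right]

theorem stdDet_normalize (y : Fin n → E n) :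
    stdDet n (fun i => NormedSpace.normalize (y i)) = (∏ i, ‖y i‖⁻¹) * stdDet n y :=
  (stdDet n).map_smul_univ _ _

variable [NeZero n]

/-- The family with `v` at the index `0` and `x` at the other indices. -/
def consZero {X : Type*} (v : X) (x : {i : Fin n // i ≠ 0} → X) : Fin n → X :=
  (Equiv.funSplitAt 0 X).symm (v, x)

@[simp]
theorem consZero_zero {X : Type*} (v : X) (x : {i : Fin n // i ≠ 0} → X) : consZero v x 0 = v := by
  simp [consZero]

theorem consZero_of_ne {X : Type*} (v : X) (x : {i : Fin n // i ≠ 0} → X) {i : Fin n}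
    (hi : i ≠ 0) : consZero v x i = x ⟨i, hi⟩ := by
  simp [consZero, hi]

variable {s : Fin n → ℝ} {y : Fin n → E n}

/-- The family of the differences between the radial projections of `y i` to the sphere of radius
`s i` and of `y 0` to the sphere of radius `s 0`. This difference vanishes for `i = 0`, and the
component with index `0` records the norms of all the vectors instead. -/
noncomputable def sphereMap (s : Fin n → ℝ) (y : Fin n → E n) : Fin n → E n :=
  consZero (WithLp.toLp 2 fun j => ‖y j‖) fun i =>
    s i • NormedSpace.normalize (y i) - s 0 • NormedSpace.normalize (y 0)

theorem exists_hasFDerivAt_sphereMap (s : Fin n → ℝ) (hy : ∀ i, y i ≠ 0) :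
    ∃ T : (Fin n → E n) →L[ℝ] (Fin n → E n), HasFDerivAt (sphereMap s) T y ∧
      (∀ w, T w 0 = WithLp.toLp 2 fun j => ⟪NormedSpace.normalize (y j), w j⟫) ∧
      ∀ w, ∀ i ≠ 0, T w i =
        (orthDilation (s i / ‖y i‖) (NormedSpace.normalize (y i)) (w i) -
          ⟪NormedSpace.normalize (y i), w i⟫ • NormedSpace.normalize (y i)) -
        (orthDilation (s 0 / ‖y 0‖) (NormedSpace.normalize (y 0)) (w 0) -
          ⟪NormedSpace.normalize (y 0), w 0⟫ • NormedSpace.normalize (y 0)) := by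
  let R (j : Fin n) : (Fin n → E n) →L[ℝ] E n :=
    (s j • ‖y j‖⁻¹ • (ContinuousLinearMap.id ℝ (E n) -
      (innerSL ℝ (NormedSpace.normalize (y j))).smulRight (NormedSpace.normalize (y j)))) ∘L
        ContinuousLinearMap.proj j
  let N : (Fin n → E n) →L[ℝ] E n :=
    (EuclideanSpace.equiv (Fin n) ℝ).symm.toContinuousLinearMap ∘L
      ContinuousLinearMap.pi fun j =>
        innerSL ℝ (NormedSpace.normalize (y j)) ∘L ContinuousLinearMap.proj j
  have hR (j : Fin n) :
      HasFDerivAt (fun y : Fin n → E n => s j • NormedSpace.normalize (y j)) (R j) y :=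
    HasFDerivAt.comp (f := fun y : Fin n → E n => y j) y
      ((hasFDerivAt_normalize (hy j)).fun_const_smul (s j)) (hasFDerivAt_apply j y)
  have hN : HasFDerivAt (fun y : Fin n → E n => (WithLp.toLp 2 fun j => ‖y j‖ : E n)) N y :=
    (EuclideanSpace.equiv (Fin n) ℝ).symm.toContinuousLinearMap.hasFDerivAt.comp y
      (hasFDerivAt_pi.2 fun j =>
        (hasFDerivAt_norm_of_ne_zero (hy j)).comp (f := fun y : Fin n → E n => y j) y
          (hasFDerivAt_apply j y))
  refine ⟨ContinuousLinearMap.pi (Function.update (fun i => R i - R 0) 0 N),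
    hasFDerivAt_pi.2 fun i => ?_, fun w => rfl, fun w i hi => ?_⟩
  · rcases eq_or_ne i 0 with rfl | hi
    · simpa [sphereMap] using hN
    · simpa [sphereMap, consZero_of_ne _ _ hi, hi] using (hR i).fun_sub (hR 0)
  · simp only [ContinuousLinearMap.coe_pi', Function.update_of_ne hi, R]
    simp [orthDilation, div_eq_mul_inv]
    module

theorem exists_hasFDerivAt_sphereMap_det (hs : ∀ i, s i ≠ 0) (hy : ∀ i, y i ≠ 0) :
    ∃ T, HasFDerivAt (sphereMap s) T y ∧
      T.det = (∏ i, (s i / ‖y i‖) ^ (n - 1)) * ((∏ i, ‖y i‖⁻¹) * stdDet n y) := by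
  obtain ⟨T, hT, hT₀, hTi⟩ := exists_hasFDerivAt_sphereMap s hy
  refine ⟨T, hT, ?_⟩
  let e (i : Fin n) : E n := NormedSpace.normalize (y i)
  have he (i : Fin n) : ‖e i‖ = 1 := NormedSpace.norm_normalize_eq_one_iff.2 (hy i)
  let P : (Fin n → E n) →ₗ[ℝ] (Fin n → E n) :=
    LinearMap.pi fun i => orthDilation (s i / ‖y i‖) (e i) ∘ₗ LinearMap.proj i
  let S : (Fin n → E n) →ₗ[ℝ] E n :=
    (WithLp.linearEquiv 2 ℝ (Fin n → ℝ)).symm.toLinearMap ∘ₗ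
      LinearMap.pi fun j => innerₛₗ ℝ (e j) ∘ₗ LinearMap.proj j
  let f (i : Fin n) : E n →ₗ[ℝ] E n :=
    (EuclideanSpace.projₗ (𝕜 := ℝ) i).smulRight (e i) -
      (EuclideanSpace.projₗ (𝕜 := ℝ) 0).smulRight (e 0)
  let pr (i : Fin n) : (Fin n → E n) →ₗ[ℝ] E n := LinearMap.proj i
  let T' : (Fin n → E n) →ₗ[ℝ] (Fin n → E n) :=
    LinearMap.pi (Function.update (fun i => pr i - pr 0 - f i ∘ₗ S) 0 S)
  have hTP : T.toLinearMap = T' ∘ₗ P := by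
    have hSP (w : Fin n → E n) : S (P w) = WithLp.toLp 2 fun j => ⟪e j, w j⟫ := by
      ext j
      exact inner_orthDilation _ (he j) (w j)
    refine LinearMap.ext fun w => funext fun i => ?_
    rcases eq_or_ne i 0 with rfl | hi
    · simpa [T', hSP] using hT₀ w
    · simp only [ContinuousLinearMap.coe_coe, hTi w i hi]
      simp [T', pr, hi, hSP, P, f, e]
      abel
  have hP : LinearMap.det P = ∏ i, (s i / ‖y i‖) ^ (n - 1) := by
    rw [LinearMap.det_pi]
    refine Finset.prod_congr rfl fun i _ => ?_
    have hei : innerₛₗ ℝ (e i) (e i) = 1 := by simp [he]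
    rw [orthDilation, det_smul_id_add_smulRight
      (div_ne_zero (hs i) (norm_ne_zero_iff.2 (hy i))) hei, finrank_euclideanSpace_fin]
  have hT' : LinearMap.det T' = LinearMap.det (innerCoords e) :=
    det_eq_of_apply_eq_sub (i₀ := 0) S f (fun w => by simp [T']) fun w i hi => by simp [T', pr, hi]
  rw [ContinuousLinearMap.det, hTP, LinearMap.det_comp, hP, hT', det_innerCoords, stdDet_normalize,
    mul_comm]

end Jacobian

section GoodConfigs

variable {n : ℕ} {s : Fin n → ℝ} {u : E n} {y : Fin n → E n}

theorem norm_smul_normalize_of_ne_zero {V : Type*} [NormedAddCommGroup V] [NormedSpace ℝ V] {t : ℝ}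
    (ht : 0 < t) {v : V} (hv : v ≠ 0) : ‖t • NormedSpace.normalize v‖ = t := by
  rw [norm_smul, NormedSpace.norm_normalize_eq_one_iff.2 hv, mul_one, Real.norm_of_nonneg ht.le]

theorem smul_normalize_mem_coneFamilies (hs : ∀ i, 0 < s i) (hy : y ∈ coneFamilies (Fin n) u) :
    (fun i => s i • NormedSpace.normalize (y i)) ∈ coneFamilies (Fin n) u := by
  simp only [NormedSpace.normalize, smul_smul]
  exact smul_mem_coneFamilies
    (fun i => mul_pos (hs i) (inv_pos.2 (norm_pos_iff.2 (hy.1.ne_zero i)))) hy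

variable [NeZero n]

/-- The positions `x` of the other centres for which the spheres of radii `s i` around the points
`consZero 0 x i`, the first of which is the origin, have a common point from which the vectors to
these centres span an open simplicial cone containing `u`. -/
def goodConfigs (u : E n) (s : Fin n → ℝ) : Set ({i : Fin n // i ≠ 0} → E n) :=
  {x | ∃ q, (∀ i, ‖consZero 0 x i - q‖ = s i) ∧
    (fun i => consZero 0 x i - q) ∈ coneFamilies (Fin n) u}

theorem injOn_sphereMap (hs : ∀ i, 0 < s i) : InjOn (sphereMap s) (coneFamilies (Fin n) u) := by
  intro y hy z hz hyz
  have hnorm (j : Fin n) : ‖y j‖ = ‖z j‖ := by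
    simpa [sphereMap] using congrArg (fun ζ : Fin n → E n => ζ 0 j) hyz
  have hdiff (i : Fin n) : s i • NormedSpace.normalize (y i) - s 0 • NormedSpace.normalize (y 0) =
      s i • NormedSpace.normalize (z i) - s 0 • NormedSpace.normalize (z 0) := by
    rcases eq_or_ne i 0 with rfl | hi
    · simp
    · simpa [sphereMap, consZero_of_ne _ _ hi] using congrFun hyz i
  have h0 : -(s 0 • NormedSpace.normalize (y 0)) = -(s 0 • NormedSpace.normalize (z 0)) := by
    refine eq_of_sub_mem_coneFamilies (u := u) (by simp)
      (x := fun i => s i • NormedSpace.normalize (y i) - s 0 • NormedSpace.normalize (y 0))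
      ?_ ?_ fun i => ?_
    · simpa using smul_normalize_mem_coneFamilies hs hy
    · simpa [hdiff] using smul_normalize_mem_coneFamilies hs hz
    · conv_rhs => rw [hdiff]
      simp only [sub_neg_eq_add, sub_add_cancel]
      rw [norm_smul_normalize_of_ne_zero (hs i) (hy.1.ne_zero i),
        norm_smul_normalize_of_ne_zero (hs i) (hz.1.ne_zero i)]
  funext i
  have hi : s i • NormedSpace.normalize (y i) = s i • NormedSpace.normalize (z i) := by
    simpa [neg_injective h0] using hdiff i
  rw [← NormedSpace.norm_smul_normalize (y i), ← NormedSpace.norm_smul_normalize (z i), hnorm i,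
    smul_right_injective _ (hs i).ne' hi]

theorem consZero_mem_image_sphereMap_iff (hs : ∀ i, 0 < s i) {v : E n}
    {x : {i : Fin n // i ≠ 0} → E n} :
    consZero v x ∈ sphereMap s '' coneFamilies (Fin n) u ↔
      (∀ j, 0 < v j) ∧ x ∈ goodConfigs u s := by
  constructor
  · rintro ⟨y, hy, hyx⟩
    have hv : v = WithLp.toLp 2 fun j => ‖y j‖ := by simpa [sphereMap] using (congrFun hyx 0).symm
    have hx (i : Fin n) : consZero 0 x i - -(s 0 • NormedSpace.normalize (y 0)) =
        s i • NormedSpace.normalize (y i) := by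
      rcases eq_or_ne i 0 with rfl | hi
      · simp
      · have := congrFun hyx i
        simp only [sphereMap, consZero_of_ne _ _ hi] at this ⊢
        rw [← this, sub_neg_eq_add, sub_add_cancel]
    refine ⟨fun j => ?_, -(s 0 • NormedSpace.normalize (y 0)), fun i => ?_, ?_⟩
    · simpa [hv] using hy.1.ne_zero j
    · rw [hx, norm_smul_normalize_of_ne_zero (hs i) (hy.1.ne_zero i)]
    · simpa only [hx] using smul_normalize_mem_coneFamilies hs hy
  · rintro ⟨hv, q, hq, hqu⟩
    refine ⟨fun i => v i • NormedSpace.normalize (consZero 0 x i - q),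
      smul_normalize_mem_coneFamilies hv hqu, ?_⟩
    have hi (i : Fin n) :
        s i • NormedSpace.normalize (v i • NormedSpace.normalize (consZero 0 x i - q)) =
          consZero 0 x i - q := by
      rw [NormedSpace.normalize_smul_of_pos (hv i), NormedSpace.normalize_normalize, ← hq i,
        NormedSpace.norm_smul_normalize]
    rw [sphereMap]
    congr
    · ext j
      exact norm_smul_normalize_of_ne_zero (hv j) (hqu.1.ne_zero j)
    · ext1 i
      rw [hi, hi]
      simp [consZero_of_ne _ _ i.2]

theorem measurePreserving_consZero (X : Type*) [MeasureSpace X]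
    [SigmaFinite (volume : Measure X)] :
    MeasurePreserving fun p : X × ({i : Fin n // i ≠ 0} → X) => consZero p.1 p.2 := by
  have hsplit := (volume_preserving_piEquivPiSubtypeProd (fun _ : Fin n => X) (· = 0)).symm
  let _ : Fintype {i : Fin n // i = 0} := Subtype.fintype (· = 0)
  have huniq := (volume_preserving_piUnique fun _ : {i : Fin n // i = 0} => X).symm
  convert hsplit.comp
    (huniq.prod (MeasurePreserving.id (volume : Measure ({i : Fin n // i ≠ 0} → X)))) using 1
  · ext1 p
    refine (Equiv.symm_apply_eq _).2 (Prod.ext ?_ (funext fun i => ?_))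
    · simp [MeasurableEquiv.piEquivPiSubtypeProd, Equiv.piEquivPiSubtypeProd]
    · simp [MeasurableEquiv.piEquivPiSubtypeProd, Equiv.piEquivPiSubtypeProd, i.2]
  · exact Measure.volume_eq_prod _ _

theorem measurableSet_image_sphereMap (hs : ∀ i, 0 < s i) :
    MeasurableSet (sphereMap s '' coneFamilies (Fin n) u) := by
  refine (isOpen_coneFamilies u).measurableSet.image_of_continuousOn_injOn (fun y hy => ?_)
    (injOn_sphereMap hs)
  obtain ⟨T, hT, -⟩ := exists_hasFDerivAt_sphereMap s hy.1.ne_zero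
  exact hT.continuousAt.continuousWithinAt

theorem measurableSet_goodConfigs (hs : ∀ i, 0 < s i) : MeasurableSet (goodConfigs u s) := by
  have h : goodConfigs u s =
      (fun x => consZero (WithLp.toLp 2 1) x) ⁻¹' (sphereMap s '' coneFamilies (Fin n) u) := by
    ext x
    simp [consZero_mem_image_sphereMap_iff hs]
  rw [h]
  exact ((measurePreserving_consZero (E n)).measurable.comp (measurable_const.prodMk measurable_id))
    (measurableSet_image_sphereMap hs)

theorem setLIntegral_image_sphereMap (hs : ∀ i, 0 < s i) {w : ℝ → ℝ≥0∞} (hw : Measurable w)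
    (hw₀ : ∀ r ≤ 0, w r = 0) :
    ∫⁻ ζ in sphereMap s '' coneFamilies (Fin n) u, ∏ j, w (ζ 0 j) =
      volume (goodConfigs u s) * (∫⁻ r, w r) ^ n := by
  have hprod (v : E n) (x : {i : Fin n // i ≠ 0} → E n) :
      (sphereMap s '' coneFamilies (Fin n) u).indicator (fun ζ => ∏ j, w (ζ 0 j)) (consZero v x) =
        (∏ j, w (v j)) * (goodConfigs u s).indicator 1 x := by
    by_cases hv : ∀ j, 0 < v j
    · by_cases hx : x ∈ goodConfigs u s <;>
        simp [indicator, consZero_mem_image_sphereMap_iff hs, hv, hx]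
    · obtain ⟨j, hj⟩ := not_forall.1 hv
      have h0 : ∏ j, w (v j) = 0 := Finset.prod_eq_zero (Finset.mem_univ j) (hw₀ _ (not_lt.1 hj))
      simp [indicator, h0]
  have hM := measurableSet_image_sphereMap (u := u) hs
  rw [← lintegral_indicator hM, ← (measurePreserving_consZero (E n)).lintegral_comp (by
    exact Measurable.indicator (by fun_prop) hM)]
  simp only [hprod]
  rw [Measure.volume_eq_prod, lintegral_prod_mul (f := fun v : E n => ∏ j, w (v j))
      (Measurable.aemeasurable (by fun_prop))
      (measurable_one.indicator (measurableSet_goodConfigs hs)).aemeasurable,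
    lintegral_indicator_one (measurableSet_goodConfigs hs), mul_comm,
    ← lintegral_pi_prod_eq_pow hw, ← (PiLp.volume_preserving_toLp (Fin n)).lintegral_comp
      (by fun_prop)]

theorem enorm_jacobian_mul_prod_gauss (hs : ∀ i, 0 < s i) (hy : ∀ i, y i ≠ 0) :
    ‖(∏ i, (s i / ‖y i‖) ^ (n - 1)) * ((∏ i, ‖y i‖⁻¹) * stdDet n y)‖ₑ *
        ∏ i, ENNReal.ofReal ‖y i‖ ^ n * gauss ‖y i‖ =
      ENNReal.ofReal (∏ i, s i ^ (n - 1)) * (‖stdDet n y‖ₑ * ∏ i, gauss (y i)) := by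
  have hfac : (∏ i, (s i / ‖y i‖) ^ (n - 1)) * (∏ i, ‖y i‖⁻¹) * ∏ i, ‖y i‖ ^ n =
      ∏ i, s i ^ (n - 1) := by
    simp only [← Finset.prod_mul_distrib]
    refine Finset.prod_congr rfl fun i _ => ?_
    have hi : ‖y i‖ ≠ 0 := norm_ne_zero_iff.2 (hy i)
    rw [← pow_sub_one_mul (NeZero.ne n) ‖y i‖]
    rw [div_pow]
    field_simp
  have hpow (i : Fin n) : ENNReal.ofReal ‖y i‖ ^ n = ENNReal.ofReal (‖y i‖ ^ n) :=
    (ENNReal.ofReal_pow (norm_nonneg _) _).symm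
  have hgauss (i : Fin n) : gauss ‖y i‖ = gauss (y i) := gauss_congr_norm (norm_norm _)
  rw [← hfac, ENNReal.ofReal_mul' (q := ∏ i, ‖y i‖ ^ n) (by positivity), ← mul_assoc, enorm_mul,
    Finset.prod_mul_distrib]
  simp only [hgauss, hpow]
  rw [← ENNReal.ofReal_prod_of_nonneg fun i _ => by positivity,
    Real.enorm_of_nonneg (mul_nonneg
      (Finset.prod_nonneg fun i _ => pow_nonneg (div_nonneg (hs i).le (norm_nonneg _)) _)
      (by positivity))]
  ring

theorem volume_goodConfigs_mul_radialMoment_pow (hs : ∀ i, 0 < s i) :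
    volume (goodConfigs u s) * radialMoment n ^ n =
      ENNReal.ofReal (∏ i, s i ^ (n - 1)) *
        ∫⁻ y in coneFamilies (Fin n) u, ‖stdDet n y‖ₑ * ∏ i, gauss (y i) := by
  have hmeas := (isOpen_coneFamilies u (n := n)).measurableSet
  choose! T hT hdet using fun y (hy : y ∈ coneFamilies (Fin n) u) =>
    exists_hasFDerivAt_sphereMap_det (fun i => (hs i).ne') hy.1.ne_zero
  let w : ℝ → ℝ≥0∞ := (Ioi 0).indicator fun r => ENNReal.ofReal r ^ n * gauss r
  have hw : Measurable w :=
    ((ENNReal.measurable_ofReal.pow_const n).mul measurable_gauss).indicator measurableSet_Ioi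
  have hradial : ∫⁻ r, w r = radialMoment n := lintegral_indicator measurableSet_Ioi _
  rw [← hradial, ← setLIntegral_image_sphereMap hs hw fun r hr =>
      indicator_of_notMem (notMem_Ioi.2 hr) _,
    lintegral_image_eq_lintegral_abs_det_fderiv_mul volume hmeas
      (fun y hy => (hT y hy).hasFDerivWithinAt) (injOn_sphereMap hs),
    ← lintegral_const_mul' _ _ ENNReal.ofReal_ne_top]
  refine setLIntegral_congr_fun hmeas fun y hy => ?_
  have hy₀ := hy.1.ne_zero
  have hwy (j : Fin n) : w (sphereMap s y 0 j) = ENNReal.ofReal ‖y j‖ ^ n * gauss ‖y j‖ := by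
    simp only [sphereMap, consZero_zero]
    exact indicator_of_mem (mem_Ioi.2 (norm_pos_iff.2 (hy₀ j))) _
  simp only [hwy, ← Real.enorm_eq_ofReal_abs, hdet y hy]
  exact enorm_jacobian_mul_prod_gauss hs hy₀

theorem volume_goodConfigs_mul (hs : ∀ i, 0 < s i) (hu : u ≠ 0) :
    volume (goodConfigs u s) * (2 * radialMoment n) ^ (n - 1) =
      ENNReal.ofReal (∏ i, s i ^ (n - 1)) := by
  have hR₀ : 2 * radialMoment n ≠ 0 := mul_ne_zero two_ne_zero (radialMoment_ne_zero n)
  have hR : 2 * radialMoment n ≠ ∞ :=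
    ENNReal.mul_ne_top ENNReal.ofNat_ne_top (radialMoment_ne_top n)
  rw [← ENNReal.mul_left_inj hR₀ hR]
  calc volume (goodConfigs u s) * (2 * radialMoment n) ^ (n - 1) * (2 * radialMoment n)
    _ = 2 ^ n * (volume (goodConfigs u s) * radialMoment n ^ n) := by
      rw [mul_assoc, pow_sub_one_mul (NeZero.ne n), mul_pow]
      ring
    _ = ENNReal.ofReal (∏ i, s i ^ (n - 1)) * detMoment n := by
      rw [volume_goodConfigs_mul_radialMoment_pow hs, detMoment_eq_two_pow_mul_setLIntegral hu]
      ring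
    _ = ENNReal.ofReal (∏ i, s i ^ (n - 1)) * (2 * radialMoment n) := by rw [detMoment_eq]

theorem volume_goodConfigs (hs : ∀ i, 0 < s i) (hu : u ≠ 0) :
    volume (goodConfigs u s) =
      ENNReal.ofReal (Real.pi ^ (((n : ℝ) ^ 2 - 1) / 2) / Real.Gamma ((1 + (n : ℝ)) / 2) ^ (n - 1) *
        ∏ i, s i ^ (n - 1)) := by
  have hπ : (Real.pi ^ (-((n + 1) / 2 : ℝ))) ^ (n - 1) * Real.pi ^ (((n : ℝ) ^ 2 - 1) / 2) = 1 := by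
    rw [← Real.rpow_mul_natCast Real.pi_pos.le, ← Real.rpow_add Real.pi_pos,
      Nat.cast_sub NeZero.one_le, Nat.cast_one]
    convert Real.rpow_zero Real.pi using 2
    ring
  have h := volume_goodConfigs_mul hs hu
  rw [two_mul_radialMoment, ← ENNReal.ofReal_pow (by positivity)] at h
  have hc : 0 < (Real.pi ^ (-((n + 1) / 2 : ℝ)) * Real.Gamma ((n + 1) / 2)) ^ (n - 1) := by
    positivity
  rw [← ENNReal.mul_left_inj (ENNReal.ofReal_ne_zero_iff.2 hc) ENNReal.ofReal_ne_top, h,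
    ← ENNReal.ofReal_mul' (by positivity), mul_pow, add_comm 1 (n : ℝ)]
  congr 1
  field_simp
  linear_combination -(∏ i, s i ^ (n - 1)) * hπ

end GoodConfigs

section Indicator

variable {d : ℕ} [NeZero d] {a : Fin d → ℝ≥0} {x : {i : Fin d // i ≠ 0} → E d} {p q : E d}

/-- The vector `-e_d`. The families of vectors whose open simplicial cone contains it are those for
which the height has a local minimum at the common point of the corresponding spheres. -/
noncomputable def down (d : ℕ) [NeZero d] : E d :=
  -EuclideanSpace.single ⟨d - 1, Nat.sub_one_lt (NeZero.ne d)⟩ 1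

theorem inner_down (v : E d) : ⟪v, down d⟫ = -height v := by
  simp [down, height, EuclideanSpace.inner_single_right]

theorem down_ne_zero : down d ≠ 0 := by
  simp [down]

theorem isLocalMinimum_iff {D : Set (E d)} :
    IsLocalMinimum D q ↔
      q ∈ D ∧ ∃ δ > 0, ∀ v, ‖v‖ < δ → v ≠ 0 → q + v ∈ D → ⟪v, down d⟫ < 0 := by
  have hlower (v : E d) : Lower q (q + v) ↔ ⟪v, down d⟫ < 0 := by
    simp [Lower, inner_down, height]
  refine and_congr_right fun _ => ⟨?_, ?_⟩
  · rintro ⟨U, hU, hmin⟩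
    obtain ⟨δ, hδ, hball⟩ := Metric.mem_nhds_iff.1 hU
    exact ⟨δ, hδ, fun v hv hv₀ hvD =>
      (hlower v).1 (hmin (q + v) ⟨hvD, hball (by simpa using hv)⟩ (by simpa using hv₀))⟩
  · rintro ⟨δ, hδ, hmin⟩
    refine ⟨ball q δ, ball_mem_nhds q hδ, fun y ⟨hyD, hy⟩ hyq => ?_⟩
    rw [← add_sub_cancel q y] at hyD ⊢
    exact (hlower _).2 (hmin _ (mem_ball_iff_norm.1 hy) (sub_ne_zero.2 hyq) hyD)

theorem config_eq_range (a : Fin d → ℝ≥0) (x : {i : Fin d // i ≠ 0} → E d) :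
    config a x = range fun i => (consZero 0 x i, a i) := by
  ext z
  simp only [config, mem_insert_iff, mem_range]
  constructor
  · rintro (rfl | ⟨i, rfl⟩)
    · exact ⟨0, by rw [consZero_zero]⟩
    · exact ⟨i, by rw [consZero_of_ne _ _ i.2]⟩
  · rintro ⟨i, rfl⟩
    rcases eq_or_ne i 0 with rfl | hi
    · exact Or.inl (by rw [consZero_zero])
    · exact Or.inr ⟨⟨i, hi⟩, by rw [consZero_of_ne _ _ hi]⟩

theorem mem_spheresInter_iff (ha : ∀ i, a i ≠ 0) :
    q ∈ spheresInter 1 (config a x) ↔ ∀ i, ‖consZero 0 x i - q‖ = a i := by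
  rw [spheresInter, config_eq_range, biInter_range, mem_iInter]
  refine forall_congr' fun i => ?_
  rw [one_mul, frontier_closedBall _ (NNReal.coe_ne_zero.2 (ha i)), mem_sphere_iff_norm,
    norm_sub_rev]

theorem mem_openBallsCompl_iff (ha : ∀ i, a i ≠ 0) :
    q ∈ openBallsCompl 1 (config a x) ↔ ∀ i, a i ≤ ‖consZero 0 x i - q‖ := by
  rw [openBallsCompl, config_eq_range, biUnion_range, compl_iUnion, mem_iInter]
  refine forall_congr' fun i => ?_
  rw [one_mul, interior_closedBall _ (NNReal.coe_ne_zero.2 (ha i)), mem_compl_iff,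
    mem_ball_iff_norm, not_lt, norm_sub_rev]

theorem isLocalMinimum_openBallsCompl_iff (ha : ∀ i, a i ≠ 0)
    (hq : ∀ i, ‖consZero 0 x i - q‖ = a i) :
    IsLocalMinimum (openBallsCompl 1 (config a x)) q ↔
      (fun i => consZero 0 x i - q) ∈ coneFamilies (Fin d) (down d) := by
  rw [isLocalMinimum_iff, and_iff_right ((mem_openBallsCompl_iff ha).2 fun i => (hq i).ge),
    mem_coneFamilies_iff_local (by simp)]
  simp only [mem_openBallsCompl_iff ha, hq, sub_sub]

theorem exists_lower_spheresInter_eq_pair (ha : ∀ i, a i ≠ 0)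
    (hq : ∀ i, ‖consZero 0 x i - q‖ = a i)
    (hcone : (fun i => consZero 0 x i - q) ∈ coneFamilies (Fin d) (down d)) :
    ∃ p, Lower p q ∧ spheresInter 1 (config a x) = {p, q} := by
  have : Nonempty (Fin d) := ⟨0⟩
  obtain ⟨w, hw, hpair⟩ := exists_setOf_norm_sub_eq_norm (by simp) hcone
  refine ⟨q + w, ?_, ?_⟩
  · rw [inner_down] at hw
    simpa [Lower, height] using hw
  · ext z
    have hz : z - q ∈ ({0, w} : Set (E d)) ↔ z ∈ spheresInter 1 (config a x) := by
      rw [← hpair, mem_spheresInter_iff ha]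
      simp [hq]
    rw [← hz]
    simp [sub_eq_iff_eq_add', or_comm]

theorem encard_config_of_mem_goodConfigs {u : E d} {s : Fin d → ℝ} (hx : x ∈ goodConfigs u s) :
    (config a x).encard = d := by
  obtain ⟨q, -, hcone⟩ := hx
  have hinj : Function.Injective fun i => (consZero 0 x i, a i) := fun i j hij =>
    hcone.1.injective (congrArg (fun z : E d × ℝ≥0 => z.1 - q) hij)
  rw [config_eq_range, ← image_univ, hinj.injOn.encard_image]
  simp

theorem h_config_of_ne_zero (ha : ∀ i, a i ≠ 0) :
    h 1 (config a x) = (goodConfigs (down d) fun i => (a i : ℝ)).indicator 1 x := by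
  classical
  rw [h, indicator_apply]
  refine if_congr ⟨?_, fun hx => ⟨encard_config_of_mem_goodConfigs hx, ?_⟩⟩ rfl rfl
  · rintro ⟨-, -, p, -, q, hq, -, hmin⟩
    rw [mem_spheresInter_iff ha] at hq
    exact ⟨q, hq, (isLocalMinimum_openBallsCompl_iff ha hq).1 hmin⟩
  · obtain ⟨q, hq, hcone⟩ := hx
    obtain ⟨p, hpq, hpair⟩ := exists_lower_spheresInter_eq_pair ha hq hcone
    have hne : p ≠ q := fun h => hpq.ne (congrArg height h)
    rw [hpair]
    exact ⟨encard_pair hne, p, by simp, q, by simp, Or.inl hpq,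
      (isLocalMinimum_openBallsCompl_iff ha hq).2 hcone⟩

theorem h_config_of_exists_eq_zero (ha : ∃ i, a i = 0) : h 1 (config a x) = 0 := by
  obtain ⟨i, hi⟩ := ha
  rw [h, if_neg]
  rintro ⟨-, htwo, -⟩
  have hsub : spheresInter 1 (config a x) ⊆ {consZero 0 x i} := fun q hq => by
    rw [spheresInter, config_eq_range, biInter_range, mem_iInter] at hq
    simpa [hi] using isClosed_closedBall.frontier_subset (hq i)
  have hle := encard_le_encard hsub
  rw [htwo, encard_singleton] at hle
  exact absurd hle (by norm_num)

end Indicator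

section Constants

variable {d : ℕ} [NeZero d]

theorem integrable_h_config (s : Fin d → ℝ≥0) :
    Integrable fun x : {i : Fin d // i ≠ 0} → E d => h 1 (config s x) := by
  by_cases hs : ∃ i, s i = 0
  · simp only [h_config_of_exists_eq_zero hs]
    exact integrable_zero _ _ _
  · push Not at hs
    have hpos (i : Fin d) : 0 < (s i : ℝ) := NNReal.coe_pos.2 (pos_iff_ne_zero.2 (hs i))
    simp only [h_config_of_ne_zero hs]
    refine (integrable_indicator_iff (measurableSet_goodConfigs hpos)).2 (integrableOn_const ?_)
    rw [volume_goodConfigs hpos down_ne_zero]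
    exact ENNReal.ofReal_ne_top

theorem integral_h_config (hd : 2 ≤ d) (s : Fin d → ℝ≥0) :
    ∫ x : {i : Fin d // i ≠ 0} → E d, h 1 (config s x) =
      Real.pi ^ (((d : ℝ) ^ 2 - 1) / 2) / Real.Gamma ((1 + (d : ℝ)) / 2) ^ (d - 1) *
        ∏ i, (s i : ℝ) ^ (d - 1) := by
  by_cases hs : ∃ i, s i = 0
  · simp only [h_config_of_exists_eq_zero hs, integral_zero]
    obtain ⟨i, hi⟩ := hs
    rw [Finset.prod_eq_zero (Finset.mem_univ i) (by rw [hi, NNReal.coe_zero, zero_pow (by omega)]),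
      mul_zero]
  · push Not at hs
    have hpos (i : Fin d) : 0 < (s i : ℝ) := NNReal.coe_pos.2 (pos_iff_ne_zero.2 (hs i))
    simp only [h_config_of_ne_zero hs]
    rw [integral_indicator_one (measurableSet_goodConfigs hpos), Measure.real,
      volume_goodConfigs hpos down_ne_zero, ENNReal.toReal_ofReal (by positivity)]

theorem G_eq (hd : 2 ≤ d) (s : Fin d → ℝ≥0) :
    G s = Real.pi ^ (((d : ℝ) ^ 2 - 1) / 2) /
      ((d ! : ℝ) * Real.Gamma ((1 + (d : ℝ)) / 2) ^ (d - 1)) * ∏ i, (s i : ℝ) ^ (d - 1) := by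
  rw [G, integral_h_config hd, ← mul_assoc, one_div_mul_eq_div, div_div, mul_comm (d ! : ℝ)]

variable (d)

theorem θ_eq : θ d = √Real.pi ^ d / Real.Gamma (1 + (d : ℝ) / 2) := by
  have : Nonempty (Fin d) := ⟨0⟩
  rw [θ, EuclideanSpace.volume_closedBall, ENNReal.ofReal_one, one_pow, one_mul,
    Fintype.card_fin, ENNReal.toReal_ofReal (by positivity), add_comm 1]

theorem θ_pos : 0 < θ d := by
  rw [θ_eq]
  positivity

theorem θ_pow_mul :
    θ d ^ (d - 1) *
      (√Real.pi * Real.Gamma (1 + (d : ℝ) / 2) / Real.Gamma ((1 + (d : ℝ)) / 2)) ^ (d - 1) =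
    Real.pi ^ (((d : ℝ) ^ 2 - 1) / 2) / Real.Gamma ((1 + (d : ℝ)) / 2) ^ (d - 1) := by
  have hbase :
      θ d * (√Real.pi * Real.Gamma (1 + (d : ℝ) / 2) / Real.Gamma ((1 + (d : ℝ)) / 2)) =
        √Real.pi ^ (d + 1) / Real.Gamma ((1 + (d : ℝ)) / 2) := by
    rw [θ_eq, pow_succ]
    field_simp
  rw [← mul_pow, hbase, div_pow, ← pow_mul, Real.sqrt_eq_rpow, ← Real.rpow_natCast,
    ← Real.rpow_mul Real.pi_pos.le, Nat.cast_mul, Nat.cast_sub NeZero.one_le]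
  congr 2
  push_cast
  ring

end Constants

section Moments

variable {d : ℕ} [NeZero d] {Ω : Type*} [MeasurableSpace Ω] {P : Measure Ω} {Q : Measure ℝ≥0}
  {Y : Ω → ℝ≥0}

theorem integrable_pow_of_le [IsFiniteMeasure P] (hY : AEMeasurable Y P) {m n : ℕ} (hmn : m ≤ n)
    (hint : Integrable (fun ω => (Y ω : ℝ) ^ n) P) :
    Integrable (fun ω => (Y ω : ℝ) ^ m) P := by
  simpa using integrable_norm_pow_of_le (f := fun ω => (Y ω : ℝ))
    hY.coe_nnreal_real.aestronglyMeasurable hmn (by simpa using hint)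

theorem integrable_G (hd : 2 ≤ d) [SigmaFinite Q] (hY : HasLaw Y Q P)
    (hint : Integrable (fun ω => (Y ω : ℝ) ^ (d - 1)) P) :
    Integrable (G (d := d)) (Measure.pi fun _ => Q) := by
  have hQ : Integrable (fun a : ℝ≥0 => (a : ℝ) ^ (d - 1)) Q := by
    rw [← hY.map_eq]
    exact (integrable_map_measure (by fun_prop) hY.aemeasurable).2 hint
  rw [show G (d := d) = _ from funext (G_eq hd)]
  exact (Integrable.fintype_prod fun _ => hQ).const_mul _

theorem c₀_eq (hd : 2 ≤ d) [SigmaFinite Q] (hY : HasLaw Y Q P) :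
    c₀ d Q = moment P Y (d - 1) ^ d * Real.pi ^ (((d : ℝ) ^ 2 - 1) / 2) /
      ((d ! : ℝ) * Real.Gamma ((1 + (d : ℝ)) / 2) ^ (d - 1)) := by
  have hQ : ∫ a : ℝ≥0, (a : ℝ) ^ (d - 1) ∂Q = moment P Y (d - 1) := by
    rw [← hY.map_eq, integral_map hY.aemeasurable (by fun_prop), moment]
  rw [c₀]
  simp only [G_eq hd]
  rw [integral_const_mul, integral_fintype_prod_eq_pow (fun a : ℝ≥0 => (a : ℝ) ^ (d - 1)), hQ,
    Fintype.card_fin]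
  ring

theorem c₀_eq_θ (hd : 2 ≤ d) [SigmaFinite Q] (hY : HasLaw Y Q P) :
    c₀ d Q = moment P Y (d - 1) ^ d * θ d ^ (d - 1) / (d ! : ℝ) *
      (√Real.pi * Real.Gamma (1 + (d : ℝ) / 2) / Real.Gamma ((1 + (d : ℝ)) / 2)) ^ (d - 1) := by
  rw [c₀_eq hd hY, div_mul_eq_mul_div, mul_assoc, θ_pow_mul, mul_div_assoc, mul_div_assoc,
    div_div, mul_comm (d ! : ℝ)]

theorem c₀_mul_α_zpow (hd : 2 ≤ d) [SigmaFinite Q] (hY : HasLaw Y Q P)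
    (hM : 0 < moment P Y d) (k : ℕ) :
    c₀ d Q * α d P Y ^ (1 - (d : ℤ)) / ((k - 1)! : ℝ) = hallJanson d k P Y := by
  have hexp : 1 - (d : ℤ) = -((d - 1 : ℕ) : ℤ) := by omega
  have hθ := (θ_pos d).ne'
  rw [c₀_eq_θ hd hY, α, hallJanson, hexp, zpow_neg, zpow_natCast, mul_pow, add_comm (d : ℝ) 1]
  field_simp

end Moments

end BooleanCoverage

theorem lemma3p2_general (d : ℕ) [NeZero d] (hd : 2 ≤ d) (Q : Measure ℝ≥0) [SigmaFinite Q]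
    {Ω : Type*} [MeasurableSpace Ω] (P : Measure Ω) (Y : Ω → ℝ≥0) (hY : HasLaw Y Q P) :
    (∀ s : Fin d → ℝ≥0,
      Integrable (fun x : {i : Fin d // i ≠ 0} → BooleanCoverage.E d =>
        BooleanCoverage.h 1 (BooleanCoverage.config s x)) ∧
      BooleanCoverage.G s =
        Real.pi ^ (((d : ℝ) ^ 2 - 1) / 2) /
            ((d ! : ℝ) * Real.Gamma ((1 + (d : ℝ)) / 2) ^ (d - 1)) *
          ∏ i, (s i : ℝ) ^ (d - 1)) ∧
    (Integrable (fun ω => (Y ω : ℝ) ^ (d - 1)) P →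
      Integrable (BooleanCoverage.G (d := d)) (Measure.pi fun _ => Q) ∧
      BooleanCoverage.c₀ d Q =
        BooleanCoverage.moment P Y (d - 1) ^ d * BooleanCoverage.θ d ^ (d - 1) / (d ! : ℝ) *
          (√Real.pi * Real.Gamma (1 + (d : ℝ) / 2) / Real.Gamma ((1 + (d : ℝ)) / 2)) ^ (d - 1) ∧
      BooleanCoverage.c₀ d Q =
        BooleanCoverage.moment P Y (d - 1) ^ d * Real.pi ^ (((d : ℝ) ^ 2 - 1) / 2) /
          ((d ! : ℝ) * Real.Gamma ((1 + (d : ℝ)) / 2) ^ (d - 1))) ∧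
    (Integrable (fun ω => (Y ω : ℝ) ^ (d - 1)) P → 0 < BooleanCoverage.moment P Y d →
      ∀ k : ℕ, 1 ≤ k →
        BooleanCoverage.c₀ d Q * BooleanCoverage.α d P Y ^ (1 - (d : ℤ)) / ((k - 1)! : ℝ) =
          BooleanCoverage.hallJanson d k P Y) :=
  ⟨fun s => ⟨BooleanCoverage.integrable_h_config s, BooleanCoverage.G_eq hd s⟩,
    fun hint => ⟨BooleanCoverage.integrable_G hd hY hint, BooleanCoverage.c₀_eq_θ hd hY,
      BooleanCoverage.c₀_eq hd hY⟩,
    fun _ hM k _ => BooleanCoverage.c₀_mul_α_zpow hd hY hM k⟩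

theorem lemma3p2 (d : ℕ) [NeZero d] (hd : 2 ≤ d)
    (Q : Measure ℝ≥0) [IsProbabilityMeasure Q]
    {Ω : Type*} [MeasurableSpace Ω] (P : Measure Ω) [IsProbabilityMeasure P]
    (Y : Ω → ℝ≥0) (hY : HasLaw Y Q P) :
    (∀ s : Fin d → ℝ≥0,
      Integrable (fun x : {i : Fin d // i ≠ 0} → BooleanCoverage.E d =>
        BooleanCoverage.h 1 (BooleanCoverage.config s x)) ∧
      BooleanCoverage.G s =
        Real.pi ^ (((d : ℝ) ^ 2 - 1) / 2) /
            ((d ! : ℝ) * Real.Gamma ((1 + (d : ℝ)) / 2) ^ (d - 1)) *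
          ∏ i, (s i : ℝ) ^ (d - 1)) ∧
    (Integrable (fun ω => (Y ω : ℝ) ^ (d - 1)) P →
      Integrable (BooleanCoverage.G (d := d)) (Measure.pi fun _ => Q) ∧
      BooleanCoverage.c₀ d Q =
        BooleanCoverage.moment P Y (d - 1) ^ d * BooleanCoverage.θ d ^ (d - 1) / (d ! : ℝ) *
          (√Real.pi * Real.Gamma (1 + (d : ℝ) / 2) / Real.Gamma ((1 + (d : ℝ)) / 2)) ^ (d - 1) ∧
      BooleanCoverage.c₀ d Q =
        BooleanCoverage.moment P Y (d - 1) ^ d * Real.pi ^ (((d : ℝ) ^ 2 - 1) / 2) /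
          ((d ! : ℝ) * Real.Gamma ((1 + (d : ℝ)) / 2) ^ (d - 1))) ∧
    (Integrable (fun ω => (Y ω : ℝ) ^ d) P → 0 < BooleanCoverage.moment P Y d →
      ∀ k : ℕ, 1 ≤ k →
        BooleanCoverage.c₀ d Q * BooleanCoverage.α d P Y ^ (1 - (d : ℤ)) / ((k - 1)! : ℝ) =
          BooleanCoverage.hallJanson d k P Y) := by
  obtain ⟨hG, hc₀, hα⟩ := lemma3p2_general d hd Q P Y hY
  exact ⟨hG, hc₀, fun hint =>
    hα (BooleanCoverage.integrable_pow_of_le hY.aemeasurable (Nat.sub_le d 1) hint)⟩
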